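/- Let $d\in\{2,3\}$, let $\Omega\subset\mathbb R^d$ be an open bounded polytope with Lipschitz boundary, let $\lambda>0$, $\mathsf a\le \mathsf b$ be real numbers and $\mathsf f,\mathsf y_\Omega\in L^2(\Omega)$. Put $\mathbb U_{ad}=\{\mathsf v\in L^2(\Omega):\mathsf a\le \mathsf v\le \mathsf b\text{ a.e. in }\Omega\}$ and $\Pi(w)(x)=\min\{\mathsf b,\max\{\mathsf a,w(x)\}\}$. Let $(\bar{\mathsf y},\bar{\mathsf p},\bar{\mathsf u})\in H^1_0(\Omega)\times H^1_0(\Omega)\times\mathbb U_{ad}$ solve, with $(\cdot,\cdot)$ the $L^2(\Omega)$ inner product, $$(\nabla\bar{\mathsf y},\nabla \mathsf v)=(\mathsf f+\bar{\mathsf u},\mathsf v)\ \ \forall \mathsf v\in H^1_0(\Omega),\qquad (\nabla \mathsf w,\nabla\bar{\mathsf p})=(\bar{\mathsf y}-\mathsf y_\Omega,\mathsf w)\ \ \forall \mathsf w\in H^1_0(\Omega),\qquad (\bar{\mathsf p}+\lambda\bar{\mathsf u},\mathsf u-\bar{\mathsf u})\ge0\ \ \forall \mathsf u\in\mathbb U_{ad}.$$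 Let $\mathscr T$ be a finite conforming simplicial mesh of $\bar\Omega$, $h_T=\operatorname{diam}(T)$, shape regular with constant $\sigma$: each $T\in\mathscr T$ contains a ball of radius $r>0$ with $h_T\le\sigma r$. Let $\mathbb V(\mathscr T)$ be the space of continuous functions on $\bar\Omega$ that are affine on each $T\in\mathscr T$ and vanish on $\partial\Omega$, and $\mathbb U_{ad}(\mathscr T)=\mathbb U_{ad}\cap\mathbb V(\mathscr T)$. Let $(\bar{\mathsf y}_{\mathscr T},\bar{\mathsf p}_{\mathscr T},\bar{\mathsf u}_{\mathscr T})\in\mathbb V(\mathscr T)\times\mathbb V(\mathscr T)\times\mathbb U_{ad}(\mathscr T)$ solve the same system with $H^1_0(\Omega)$ replaced by $\mathbb V(\mathscr T)$ and $\mathbb U_{ad}$ by $\mathbb U_{ad}(\mathscr T)$ (with the same $\mathsf f$, $\mathsf y_\Omega$). For $T\in\mathscr T$ let $\mathcal N_T$ consist of $T$ and of all elements that share with $T$ a common $(d-1)$-dimensional side; $L^\infty(\mathcal N_T)$ refers to the union of these elements. On the common side $S$ of two elements $T^\pm$ the jump is $\llbracket\nabla w\cdot\nu\rrbracket=\nu^+\cdot\nabla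 w_{|T^+}+\nu^-\cdot\nabla w_{|T^-}$, with $\nu^\pm$ the unit normal to $S$ pointing towards $T^\pm$. Define the indicators $$\mathscr E_{\mathsf y}(T)=h_T^{2-d/2}\|\mathsf f+\bar{\mathsf u}_{\mathscr T}\|_{L^2(T)}+h_T\|\llbracket\nabla\bar{\mathsf y}_{\mathscr T}\cdot\nu\rrbracket\|_{L^\infty(\partial T\setminus\partial\Omega)},$$ $$\mathscr E_{\mathsf p}(T)=h_T^{2-d/2}\|\bar{\mathsf y}_{\mathscr T}-\mathsf y_\Omega\|_{L^2(T)}+h_T\|\llbracket\nabla\bar{\mathsf p}_{\mathscr T}\cdot\nu\rrbracket\|_{L^\infty(\partial T\setminus\partial\Omega)},$$ $$\mathscr E_{\mathsf u}(T)=\|\Pi(-\bar{\mathsf p}_{\mathscr T}/\lambda)-\bar{\mathsf u}_{\mathscr T}\|_{L^\infty(T)},\qquad \mathscr E(T)=\big(\mathscr E_{\mathsf y}(T)^2+\mathscr E_{\mathsf p}(T)^2+\mathscr E_{\mathsf u}(T)^2\big)^{1/2},$$ and the global estimator $$\mathscr E(\mathscr T)=\Big(\big(\max_{T\in\mathscr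 T}\mathscr E_{\mathsf y}(T)\big)^2+\big(\max_{T\in\mathscr T}\mathscr E_{\mathsf p}(T)\big)^2+\big(\max_{T\in\mathscr T}\mathscr E_{\mathsf u}(T)\big)^2\Big)^{1/2}.$$ Let $\mathcal P_{\mathscr T}$ be the $L^2(\Omega)$-projection onto the (discontinuous) piecewise linear functions over $\mathscr T$ and, for $g\in L^2(\Omega)$ and $\mathcal M\subset\mathscr T$, $\operatorname{osc}_{\mathscr T}(g;\mathcal M)^2=\sum_{T\in\mathcal M}h_T^{4-d}\|g-\mathcal P_{\mathscr T}g\|_{L^2(T)}^2$. Then there is a constant $C$ depending only on $d$, $\Omega$, $\lambda$ and $\sigma$ (in particular not on the sizes or the number of the elements of $\mathscr T$) such that for every $T\in\mathscr T$ $$\mathscr E(T)\le C\big(\|\bar{\mathsf y}-\bar{\mathsf y}_{\mathscr T}\|_{L^\infty(\mathcal N_T)}+\|\bar{\mathsf p}-\bar{\mathsf p}_{\mathscr T}\|_{L^\infty(\mathcal N_T)}+\|\bar{\mathsf u}-\bar{\mathsf u}_{\mathscr T}\|_{L^\infty(\mathcal N_T)}+\operatorname{osc}_{\mathscr T}(\mathsf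 f;\mathcal N_T)+\operatorname{osc}_{\mathscr T}(\mathsf y_\Omega;\mathcal N_T)\big),$$ and $$\mathscr E(\mathscr T)\le C\Big(\big(\|\bar{\mathsf y}-\bar{\mathsf y}_{\mathscr T}\|_{L^\infty(\Omega)}^2+\|\bar{\mathsf p}-\bar{\mathsf p}_{\mathscr T}\|_{L^\infty(\Omega)}^2+\|\bar{\mathsf u}-\bar{\mathsf u}_{\mathscr T}\|_{L^\infty(\Omega)}^2\big)^{1/2}+\max_{T\in\mathscr T}\operatorname{osc}_{\mathscr T}(\mathsf f;\mathcal N_T)+\max_{T\in\mathscr T}\operatorname{osc}_{\mathscr T}(\mathsf y_\Omega;\mathcal N_T)\Big).$$ -/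

import Mathlib

open MeasureTheory Filter Topology Set
open scoped ENNReal NNReal ContDiff

noncomputable section

namespace OCP

/-- Euclidean space `ℝ^d`. -/
abbrev E (d : ℕ) := EuclideanSpace ℝ (Fin d)

variable {d : ℕ}

/-- `Ω` has a Lipschitz boundary: near each boundary point it is, in a suitable direction `e`, the
region strictly above the graph of a Lipschitz function `φ` of the variables orthogonal to `e`. -/
def HasLipschitzBoundary (Ω : Set (E d)) : Prop :=
  ∀ x ∈ frontier Ω, ∃ (e : E d) (φ : E d → ℝ) (K : ℝ≥0) (r : ℝ),
    ‖e‖ = 1 ∧ LipschitzWith K φ ∧ (∀ (z : E d) (t : ℝ), φ (z + t • e) = φ z) ∧ 0 < r ∧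
      ∀ z ∈ Metric.ball x r, z ∈ Ω ↔ φ z < inner ℝ e z

/-- The closed simplex spanned by a finite set of points. -/
def simplex (T : Finset (E d)) : Set (E d) := convexHull ℝ (T : Set (E d))

/-- `h_T`, the diameter of the simplex. -/
def size (T : Finset (E d)) : ℝ := Metric.diam (simplex T)

/-- A conforming simplicial mesh of the closure of `Ω`; an element is given by its vertices. Two
elements intersect in the simplex spanned by their common vertices (possibly empty). Since there
are finitely many elements, such a mesh exists only if `Ω` is a bounded polytope. -/
structure Mesh (Ω : Set (E d)) where
  elems : Finset (Finset (E d))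
  card_eq : ∀ T ∈ elems, T.card = d + 1
  indep : ∀ T ∈ elems, AffineIndependent ℝ ((↑) : T → E d)
  conforming : ∀ T ∈ elems, ∀ T' ∈ elems,
    simplex T ∩ simplex T' = convexHull ℝ ((T : Set (E d)) ∩ (T' : Set (E d)))
  cover : (⋃ T ∈ elems, simplex T) = closure Ω

variable {Ω : Set (E d)}

/-- Shape regularity with constant `σ`: each element contains a ball of radius `r > 0` with
`h_T ≤ σ r`. -/
def Mesh.ShapeRegular (M : Mesh Ω) (σ : ℝ) : Prop :=
  ∀ T ∈ M.elems, ∃ (x : E d) (r : ℝ),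
    0 < r ∧ Metric.closedBall x r ⊆ simplex T ∧ size T ≤ σ * r

/-- `S` (given by its `d` vertices) is an internal `(d-1)`-dimensional interelement boundary. -/
def Mesh.IsSide (M : Mesh Ω) (S : Finset (E d)) : Prop :=
  S.card = d ∧ ∃ T ∈ M.elems, ∃ T' ∈ M.elems, T ≠ T' ∧ S ⊆ T ∧ S ⊆ T'

open Classical in
/-- `N_T`: the element `T` and all elements that share an internal side with it. -/
def Mesh.patch (M : Mesh Ω) (T : Finset (E d)) : Finset (Finset (E d)) :=
  M.elems.filter fun T' => T' = T ∨ ∃ S, M.IsSide S ∧ S ⊆ T ∧ S ⊆ T'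

/-- The region covered by a set of elements. -/
def region (N : Finset (Finset (E d))) : Set (E d) := ⋃ T ∈ N, simplex T

/-- The finite element space: functions continuous on the closure of `Ω`, affine on each element,
zero on the boundary. (Values outside the closure of `Ω` are irrelevant.) -/
def Mesh.FE (M : Mesh Ω) (w : E d → ℝ) : Prop :=
  ContinuousOn w (closure Ω) ∧
  (∀ T ∈ M.elems, ∃ A : E d →ᵃ[ℝ] ℝ, ∀ x ∈ simplex T, w x = A x) ∧
  ∀ x ∈ frontier Ω, w x = 0

/-- `v ∈ H^1_0(Ω)` with weak gradient `G`: the pair `(v, G)` is the `L^2(Ω)` limit of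
`(φ_n, ∇φ_n)` with `φ_n ∈ C_c^∞(Ω)`. -/
def IsH10 (Ω : Set (E d)) (v : E d → ℝ) (G : E d → E d) : Prop :=
  MemLp v 2 (volume.restrict Ω) ∧ MemLp G 2 (volume.restrict Ω) ∧
  ∃ φ : ℕ → E d → ℝ,
    (∀ n, ContDiff ℝ ∞ (φ n) ∧ HasCompactSupport (φ n) ∧ tsupport (φ n) ⊆ Ω) ∧
    Tendsto (fun n => eLpNorm (fun x => φ n x - v x) 2 (volume.restrict Ω)) atTop (𝓝 0) ∧
    Tendsto (fun n => eLpNorm (fun x => gradient (φ n) x - G x) 2 (volume.restrict Ω))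
      atTop (𝓝 0)

/-- The admissible controls. -/
def Uad (Ω : Set (E d)) (a b : ℝ) (u : E d → ℝ) : Prop :=
  MemLp u 2 (volume.restrict Ω) ∧ ∀ᵐ x ∂(volume.restrict Ω), a ≤ u x ∧ u x ≤ b

/-- `(y, p, u)` solves the optimality system of the control problem. -/
structure IsSolution (Ω : Set (E d)) (f yΩ : E d → ℝ) (lam a b : ℝ) (y p u : E d → ℝ) :
    Prop where
  state : ∃ Gy, IsH10 Ω y Gy ∧ ∀ v Gv, IsH10 Ω v Gv →
    ∫ x in Ω, inner ℝ (Gy x) (Gv x) = ∫ x in Ω, (f x + u x) * v x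
  adjoint : ∃ Gp, IsH10 Ω p Gp ∧ ∀ w Gw, IsH10 Ω w Gw →
    ∫ x in Ω, inner ℝ (Gw x) (Gp x) = ∫ x in Ω, (y x - yΩ x) * w x
  admissible : Uad Ω a b u
  variational : ∀ v, Uad Ω a b v → 0 ≤ ∫ x in Ω, (p x + lam * u x) * (v x - u x)

/-- `(y, p, u)` solves the discrete optimality system. Finite element functions are affine near
almost every point of `Ω`, so `gradient` is there their (piecewise constant) weak gradient. -/
structure Mesh.IsDiscreteSolution (M : Mesh Ω) (f yΩ : E d → ℝ) (lam a b : ℝ)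
    (y p u : E d → ℝ) : Prop where
  state_mem : M.FE y
  adjoint_mem : M.FE p
  control_mem : M.FE u
  state : ∀ v, M.FE v →
    ∫ x in Ω, inner ℝ (gradient y x) (gradient v x) = ∫ x in Ω, (f x + u x) * v x
  adjoint : ∀ w, M.FE w →
    ∫ x in Ω, inner ℝ (gradient w x) (gradient p x) = ∫ x in Ω, (y x - yΩ x) * w x
  admissible : Uad Ω a b u
  variational : ∀ v, M.FE v → Uad Ω a b v →
    0 ≤ ∫ x in Ω, (p x + lam * u x) * (v x - u x)

/-- `ν` is the unit normal to the side `S` of the simplex `T` pointing towards `T`. -/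
def IsNormalTowards (S T : Finset (E d)) (ν : E d) : Prop :=
  ‖ν‖ = 1 ∧ (∀ p ∈ S, ∀ q ∈ S, inner ℝ ν (p - q) = 0) ∧
    ∀ p ∈ S, ∀ z ∈ T, 0 ≤ inner ℝ ν (z - p)

/-- The unit normal to the side `S` of the simplex `T` pointing towards `T`. -/
def normalTowards (S T : Finset (E d)) : E d := Classical.epsilon (IsNormalTowards S T)

/-- The jump of the normal derivative of `w` across the common side `S` of `T` and `T'`;
`gradientWithin w (simplex T) x` is the gradient at `x` of the restriction of `w` to `T`. -/
def jump (w : E d → ℝ) (S T T' : Finset (E d)) (x : E d) : ℝ :=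
  inner ℝ (normalTowards S T) (gradientWithin w (simplex T) x) +
    inner ℝ (normalTowards S T') (gradientWithin w (simplex T') x)

/-- The `L^∞` norm of the jump over `∂T \ ∂Ω`, that is, over the internal sides of `T`. -/
def Mesh.jumpNorm (M : Mesh Ω) (w : E d → ℝ) (T : Finset (E d)) : ℝ≥0∞ :=
  ⨆ T' ∈ M.elems, ⨆ S : Finset (E d), ⨆ _ : T' ≠ T ∧ S.card = d ∧ S ⊆ T ∧ S ⊆ T',
    eLpNorm (jump w S T T') ∞ ((Measure.hausdorffMeasure ((d : ℝ) - 1)).restrict (simplex S))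

/-- The `L^∞` norm on a set. -/
def supNorm (g : E d → ℝ) (s : Set (E d)) : ℝ≥0∞ := eLpNorm g ∞ (volume.restrict s)

/-- The `L^2` norm on a set. -/
def l2Norm (g : E d → ℝ) (s : Set (E d)) : ℝ≥0∞ := eLpNorm g 2 (volume.restrict s)

/-- `h_T` as an extended nonnegative real. -/
def hE (T : Finset (E d)) : ℝ≥0∞ := ENNReal.ofReal (size T)

/-- The projection onto `[a, b]`. -/
def proj (a b : ℝ) (w : E d → ℝ) (x : E d) : ℝ := min b (max a (w x))

/-- The local indicator of the residual `g` and of the jumps of `w`. -/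
def Mesh.resInd (M : Mesh Ω) (g w : E d → ℝ) (T : Finset (E d)) : ℝ≥0∞ :=
  hE T ^ (2 - (d : ℝ) / 2) * l2Norm g (simplex T) + hE T * M.jumpNorm w T

/-- The local state indicator. -/
def Mesh.indY (M : Mesh Ω) (f y u : E d → ℝ) (T : Finset (E d)) : ℝ≥0∞ :=
  M.resInd (fun x => f x + u x) y T

/-- The local adjoint indicator. -/
def Mesh.indP (M : Mesh Ω) (yΩ p y : E d → ℝ) (T : Finset (E d)) : ℝ≥0∞ :=
  M.resInd (fun x => y x - yΩ x) p T

/-- The local control indicator. -/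
def indU (lam a b : ℝ) (u p : E d → ℝ) (T : Finset (E d)) : ℝ≥0∞ :=
  supNorm (fun x => proj a b (fun z => -p z / lam) x - u x) (simplex T)

/-- The local indicator of the whole system. -/
def Mesh.ind (M : Mesh Ω) (f yΩ : E d → ℝ) (lam a b : ℝ) (y p u : E d → ℝ)
    (T : Finset (E d)) : ℝ≥0∞ :=
  (M.indY f y u T ^ 2 + M.indP yΩ p y T ^ 2 + indU lam a b u p T ^ 2) ^ (1 / 2 : ℝ)

/-- The global estimator: the Euclidean combination of the maxima of the three indicators. -/
def Mesh.estimator (M : Mesh Ω) (f yΩ : E d → ℝ) (lam a b : ℝ) (y p u : E d → ℝ) : ℝ≥0∞ :=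
  ((⨆ T ∈ M.elems, M.indY f y u T) ^ 2 + (⨆ T ∈ M.elems, M.indP yΩ p y T) ^ 2 +
    (⨆ T ∈ M.elems, indU lam a b u p T) ^ 2) ^ (1 / 2 : ℝ)

/-- `q` is a (possibly discontinuous) piecewise linear function over the mesh. Its values on the
boundaries of the elements, a null set, are irrelevant. -/
def Mesh.PiecewiseAffine (M : Mesh Ω) (q : E d → ℝ) : Prop :=
  ∀ T ∈ M.elems, ∃ A : E d →ᵃ[ℝ] ℝ, ∀ x ∈ interior (simplex T), q x = A x

/-- `q` is the `L^2(Ω)` projection of `g` onto the piecewise linear functions. -/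
def Mesh.IsL2Proj (M : Mesh Ω) (g q : E d → ℝ) : Prop :=
  M.PiecewiseAffine q ∧ ∀ v, M.PiecewiseAffine v → ∫ x in Ω, (g x - q x) * v x = 0

/-- The `L^2(Ω)` projection of `g` onto the piecewise linear functions (it exists for every
`g ∈ L^2(Ω)` and is unique up to null sets). -/
def Mesh.l2Proj (M : Mesh Ω) (g : E d → ℝ) : E d → ℝ := Classical.epsilon (M.IsL2Proj g)

/-- The data oscillation over a set `N` of elements. -/
def Mesh.osc (M : Mesh Ω) (g : E d → ℝ) (N : Finset (Finset (E d))) : ℝ≥0∞ :=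
  (∑ T ∈ N, hE T ^ (4 - (d : ℝ)) * l2Norm (fun x => g x - M.l2Proj g x) (simplex T) ^ 2)
    ^ (1 / 2 : ℝ)

/-- The total error `‖(e_y, e_p, e_u)‖_Ω`. -/
def totalError (Ω : Set (E d)) (ey ep eu : E d → ℝ) : ℝ≥0∞ :=
  (supNorm ey Ω ^ 2 + supNorm ep Ω ^ 2 + supNorm eu Ω ^ 2) ^ (1 / 2 : ℝ)

end OCP

end

/-! State and adjoint are both distributional solutions of `-ΔW = D + s`, with data `D` in `L²` and
a coupled variable `s`. Let `w`, `sT` be the finite element approximations of `W`, `s`, and `Q` the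
piecewise affine projection of `D`. Testing with a smooth bump `φ` and moving both derivatives onto
`φ` gives `∫ w Δφ + ∫ (Q + sT) φ = -∫ (W - w) Δφ - ∫ (D - Q) φ - ∫ (s - sT) φ`. No derivative of the
error occurs, so the right side is controlled by sup norms and the oscillation (`weak_error`). The
two residual bounds come from two choices of `φ`, always a product bump of scale `ρ` comparable to
`h_T`.

Interior residual (`exists_element_bound`): if the support lies in the ball inscribed in `T`, the
affine `w` is annihilated by `Δφ`, and the even bump averages the affine `Q + sT` to its value at
the centre. Values at the points of a smaller ball control an affine function on all of `T`.

Jump (`exists_jump_bound`): around the barycentre `z` of a side with unit normal `ν`, `w` is an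
affine function plus `J (ν·(x - z))₊`, where `J` is the jump. A bump whose first axis is `ν` gives
exactly `∫ w Δφ = J ρ^(d-1) mass^(d-1)`, and `∫ (Q + sT) φ` is bounded by the interior estimate on
the two elements.

Control (`control_eq_proj`, `indU_le`): the variational inequality means `u = Π(-p/λ)` almost
everywhere, and `Π` is 1-Lipschitz.

Shape regularity makes all scales comparable, with ratios depending only on `d` and `σ`; `Ω` enters
the constant only through its diameter, an upper bound of `h_T`. -/

noncomputable section

namespace OCP

variable {d : ℕ} {Ω : Set (E d)}

/-! ### Test functions and the distributional Laplacian -/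

/-- The Laplacian computed in an orthonormal basis. -/
def lap (b : OrthonormalBasis (Fin d) ℝ (E d)) (φ : E d → ℝ) (x : E d) : ℝ :=
  ∑ i, fderiv ℝ (fun y => fderiv ℝ φ y (b i)) x (b i)

/-- The smooth functions with compact support in `Ω`. -/
structure IsTest (Ω : Set (E d)) (φ : E d → ℝ) : Prop where
  contDiff : ContDiff ℝ ∞ φ
  compact : HasCompactSupport φ
  subset : tsupport φ ⊆ Ω

lemma contDiff_fderiv_apply {φ : E d → ℝ} (hφ : ContDiff ℝ ∞ φ) (v : E d) :
    ContDiff ℝ ∞ (fun y => fderiv ℝ φ y v) :=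
  (hφ.fderiv_right (m := ∞) (by simp)).clm_apply contDiff_const

lemma continuous_lap (b : OrthonormalBasis (Fin d) ℝ (E d)) {φ : E d → ℝ}
    (hφ : ContDiff ℝ ∞ φ) : Continuous (lap b φ) :=
  continuous_finsetSum _ fun _ _ =>
    (contDiff_fderiv_apply (contDiff_fderiv_apply hφ _) _).continuous

lemma lap_eq_zero (b : OrthonormalBasis (Fin d) ℝ (E d)) {φ : E d → ℝ} {x : E d}
    (hx : x ∉ tsupport φ) : lap b φ x = 0 := by
  refine Finset.sum_eq_zero fun i _ => ?_
  have h1 : x ∉ tsupport (fun y => fderiv ℝ (fun y => fderiv ℝ φ y (b i)) y (b i)) := fun h =>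
    hx (tsupport_fderiv_apply_subset ℝ _ (tsupport_fderiv_apply_subset ℝ _ h))
  exact image_eq_zero_of_notMem_tsupport
    (f := fun y => fderiv ℝ (fun y => fderiv ℝ φ y (b i)) y (b i)) h1

lemma hasCompactSupport_lap (b : OrthonormalBasis (Fin d) ℝ (E d)) {φ : E d → ℝ}
    (hφ : HasCompactSupport φ) : HasCompactSupport (lap b φ) :=
  HasCompactSupport.intro hφ fun _ hx => lap_eq_zero b hx

lemma integral_mul_fderiv {w φ : E d → ℝ} (hw : ContDiff ℝ 1 w) (hφ : ContDiff ℝ 1 φ)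
    (hc : HasCompactSupport φ) (v : E d) :
    ∫ x, w x * fderiv ℝ φ x v = -∫ x, fderiv ℝ w x v * φ x := by
  have hw' : Continuous fun x => fderiv ℝ w x v :=
    (hw.continuous_fderiv (by simp)).clm_apply continuous_const
  have hφ' : Continuous fun x => fderiv ℝ φ x v :=
    (hφ.continuous_fderiv (by simp)).clm_apply continuous_const
  apply integral_mul_fderiv_eq_neg_fderiv_mul_of_integrable
  · exact (hw'.mul hφ.continuous).integrable_of_hasCompactSupport hc.mul_left
  · exact (hw.continuous.mul hφ').integrable_of_hasCompactSupport (hc.fderiv_apply ℝ v).mul_left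
  · exact (hw.continuous.mul hφ.continuous).integrable_of_hasCompactSupport hc.mul_left
  · exact fun x _ => (hw.differentiable (by simp)).differentiableAt
  · exact fun x _ => (hφ.differentiable (by simp)).differentiableAt

lemma integral_mul_lap (b : OrthonormalBasis (Fin d) ℝ (E d)) {w φ : E d → ℝ}
    (hw : ContDiff ℝ 1 w) (hφ : ContDiff ℝ ∞ φ) (hc : HasCompactSupport φ) :
    ∫ x, w x * lap b φ x = -∑ i, ∫ x, fderiv ℝ w x (b i) * fderiv ℝ φ x (b i) := by
  have h : ∀ i, Integrable fun x => w x * fderiv ℝ (fun y => fderiv ℝ φ y (b i)) x (b i) :=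
    fun i => (hw.continuous.mul (contDiff_fderiv_apply
      (contDiff_fderiv_apply hφ _) _).continuous).integrable_of_hasCompactSupport
        ((hc.fderiv_apply ℝ (b i)).fderiv_apply ℝ (b i)).mul_left
  simp only [lap, Finset.mul_sum]
  rw [integral_finsetSum _ fun i _ => h i, ← Finset.sum_neg_distrib]
  exact Finset.sum_congr rfl fun i _ => integral_mul_fderiv hw
    ((contDiff_fderiv_apply hφ _).of_le (by norm_cast)) (hc.fderiv_apply ℝ (b i)) _

lemma contDiff_affine (A : E d →ᵃ[ℝ] ℝ) {n : WithTop ℕ∞} : ContDiff ℝ n A := by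
  rw [A.decomp]
  exact (LinearMap.toContinuousLinearMap A.linear).contDiff.add contDiff_const

lemma fderiv_affine (A : E d →ᵃ[ℝ] ℝ) (x v : E d) : fderiv ℝ A x v = A.linear v := by
  have h : HasFDerivAt A (LinearMap.toContinuousLinearMap A.linear) x := by
    rw [A.decomp]
    exact (LinearMap.toContinuousLinearMap A.linear).hasFDerivAt.add_const _
  rw [h.fderiv]; rfl

/-- The gradient is constant, and the integral of a derivative of a test function vanishes. This
removes the affine part of a finite element function from the tested equation. -/
lemma integral_affine_mul_lap (b : OrthonormalBasis (Fin d) ℝ (E d)) (A : E d →ᵃ[ℝ] ℝ)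
    {φ : E d → ℝ} (hφ : ContDiff ℝ ∞ φ) (hc : HasCompactSupport φ) :
    ∫ x, A x * lap b φ x = 0 := by
  rw [integral_mul_lap b (contDiff_affine A) hφ hc, neg_eq_zero]
  refine Finset.sum_eq_zero fun i _ => ?_
  simp only [fderiv_affine]
  rw [integral_mul_fderiv (w := fun _ => A.linear (b i)) contDiff_const
    (hφ.of_le (by norm_cast)) hc]
  simp

lemma tendsto_integral_inner {α F : Type*} [MeasurableSpace α] {μ : Measure α}
    [NormedAddCommGroup F] [InnerProductSpace ℝ F] {u : ℕ → α → F} {v g : α → F}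
    (hu : ∀ n, MemLp (u n) 2 μ) (hv : MemLp v 2 μ) (hg : MemLp g 2 μ)
    (h : Tendsto (fun n => eLpNorm (fun x => u n x - v x) 2 μ) atTop (𝓝 0)) :
    Tendsto (fun n => ∫ x, inner ℝ (u n x) (g x) ∂μ) atTop (𝓝 (∫ x, inner ℝ (v x) (g x) ∂μ)) := by
  have key : ∀ {w : α → F} (hw : MemLp w 2 μ),
      ∫ x, inner ℝ (w x) (g x) ∂μ = inner ℝ (hw.toLp w) (hg.toLp g) := by
    intro w hw
    rw [L2.inner_def]
    refine integral_congr_ae ?_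
    filter_upwards [hw.coeFn_toLp, hg.coeFn_toLp] with x h1 h2
    rw [h1, h2]
  simp only [key hv, fun n => key (hu n)]
  refine Tendsto.inner ?_ tendsto_const_nhds
  exact (Lp.tendsto_Lp_iff_tendsto_eLpNorm'' u hu v hv).2 h

lemma IsTest.setIntegral_eq {φ : E d → ℝ} (hφ : IsTest Ω φ) {F : E d → ℝ}
    (hF : ∀ x, x ∉ tsupport φ → F x = 0) : ∫ x in Ω, F x = ∫ x, F x :=
  setIntegral_eq_integral_of_forall_compl_eq_zero fun x hx => hF x fun h => hx (hφ.subset h)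

lemma continuous_gradient {φ : E d → ℝ} (hφ : ContDiff ℝ ∞ φ) : Continuous (gradient φ) :=
  (InnerProductSpace.toDual ℝ (E d)).symm.continuous.comp (hφ.continuous_fderiv (by simp))

lemma gradient_eq_zero {φ : E d → ℝ} {x : E d} (hx : x ∉ tsupport φ) : gradient φ x = 0 := by
  have : fderiv ℝ φ x = 0 := by
    by_contra h
    exact hx (support_fderiv_subset ℝ h)
  simp [gradient, this]

lemma hasCompactSupport_gradient {φ : E d → ℝ} (hc : HasCompactSupport φ) :
    HasCompactSupport (gradient φ) :=
  HasCompactSupport.intro hc fun _ hx => gradient_eq_zero hx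

/-- A function of `H^1_0` is integrated by parts against a test function. -/
lemma IsH10.integral_inner_gradient {v : E d → ℝ} {G : E d → E d} (hv : IsH10 Ω v G)
    (b : OrthonormalBasis (Fin d) ℝ (E d)) {φ : E d → ℝ} (hφ : IsTest Ω φ) :
    ∫ x in Ω, inner ℝ (G x) (gradient φ x) = -∫ x in Ω, v x * lap b φ x := by
  obtain ⟨hv2, hG2, ψ, hψ, h1, h2⟩ := hv
  have A := tendsto_integral_inner
    (fun n => Continuous.memLp_of_hasCompactSupport (continuous_gradient (hψ n).1)
      (hasCompactSupport_gradient (hψ n).2.1)) hG2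
    (Continuous.memLp_of_hasCompactSupport (continuous_gradient hφ.contDiff)
      (hasCompactSupport_gradient hφ.compact)) h2
  have B := tendsto_integral_inner
    (fun n => Continuous.memLp_of_hasCompactSupport (hψ n).1.continuous (hψ n).2.1) hv2
    (Continuous.memLp_of_hasCompactSupport (continuous_lap b hφ.contDiff)
      (hasCompactSupport_lap b hφ.compact)) h1
  have hinner : ∀ s t : ℝ, inner ℝ s t = s * t := fun s t => by simp [mul_comm]
  simp only [hinner] at B
  -- For each smooth approximant the identity is classical integration by parts; the two `L²` limits
  -- `A` and `B` transfer it to `v`.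
  refine tendsto_nhds_unique A (B.neg.congr fun n => ?_)
  rw [hφ.setIntegral_eq (fun x hx => by simp [lap_eq_zero b hx]),
    hφ.setIntegral_eq (fun x hx => by simp [gradient_eq_zero hx]),
    integral_mul_lap b ((hψ n).1.of_le (by norm_cast)) hφ.contDiff hφ.compact, neg_neg,
    ← integral_finsetSum]
  · refine integral_congr_ae (Eventually.of_forall fun x => ?_)
    simp only
    rw [← b.sum_inner_mul_inner]
    refine Finset.sum_congr rfl fun i _ => ?_
    rw [inner_gradient_left, real_inner_comm, inner_gradient_left]
  · intro i _
    exact ((contDiff_fderiv_apply (hψ n).1 _).continuous.mul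
      (contDiff_fderiv_apply hφ.contDiff _).continuous).integrable_of_hasCompactSupport
        (hφ.compact.fderiv_apply ℝ (b i)).mul_left

lemma IsTest.isH10 {φ : E d → ℝ} (hφ : IsTest Ω φ) : IsH10 Ω φ (gradient φ) :=
  ⟨Continuous.memLp_of_hasCompactSupport hφ.contDiff.continuous hφ.compact,
    Continuous.memLp_of_hasCompactSupport (continuous_gradient hφ.contDiff)
      (hasCompactSupport_gradient hφ.compact),
    fun _ => φ, fun _ => ⟨hφ.contDiff, hφ.compact, hφ.subset⟩, by simp, by simp⟩

/-! ### The one-dimensional cutoff and its second derivative -/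

/-- A smooth even bump on the line, supported in `[-1, 1]`. -/
def cutoff : ContDiffBump (0 : ℝ) := ⟨1 / 2, 1, by norm_num, by norm_num⟩

lemma cutoff_contDiff : ContDiff ℝ ∞ cutoff := cutoff.contDiff

lemma cutoff_neg (t : ℝ) : cutoff (-t) = cutoff t := cutoff.neg t

lemma cutoff_zero : cutoff 0 = 1 := cutoff.one_of_mem_closedBall (by simp [cutoff])

lemma cutoff_eq_zero {t : ℝ} (ht : 1 ≤ |t|) : cutoff t = 0 :=
  cutoff.zero_of_le_dist (by simpa [cutoff] using ht)

lemma cutoff_hasCompactSupport : HasCompactSupport cutoff := cutoff.hasCompactSupport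

/-- The mass of the cutoff. -/
def mass : ℝ := ∫ t, cutoff t

lemma mass_pos : 0 < mass := cutoff.integral_pos

/-- The second derivative of the cutoff. -/
def cutoff'' : ℝ → ℝ := deriv (deriv cutoff)

lemma deriv_cutoff_contDiff : ContDiff ℝ ∞ (deriv cutoff) :=
  (contDiff_infty_iff_deriv.1 cutoff_contDiff).2

lemma cutoff''_continuous : Continuous cutoff'' :=
  (contDiff_infty_iff_deriv.1 deriv_cutoff_contDiff).2.continuous

lemma cutoff''_hasCompactSupport : HasCompactSupport cutoff'' :=
  cutoff_hasCompactSupport.deriv.deriv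

lemma exists_cutoff''_bound : ∃ L : ℝ, 0 ≤ L ∧ ∀ t, |cutoff'' t| ≤ L := by
  obtain ⟨L, hL⟩ := cutoff''_continuous.bounded_above_of_compact_support
    cutoff''_hasCompactSupport
  exact ⟨L, (norm_nonneg _).trans (hL 0), hL⟩

/-- Makes the tangential second derivatives drop out when the Laplacian of a bump is tested with a
function of the normal coordinate alone. -/
lemma integral_cutoff'' : ∫ t, cutoff'' t = 0 :=
  integral_eq_zero_of_hasDerivAt_of_integrable
    (fun t => ((deriv_cutoff_contDiff.differentiable (by simp)) t).hasDerivAt)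
    (cutoff''_continuous.integrable_of_hasCompactSupport cutoff''_hasCompactSupport)
    (deriv_cutoff_contDiff.continuous.integrable_of_hasCompactSupport
      cutoff_hasCompactSupport.deriv)

/-- The second distributional derivative of `max t 0` is the Dirac mass at `0`, and `cutoff 0 = 1`.
-/
lemma integral_max_mul_cutoff'' : ∫ t, max t 0 * cutoff'' t = 1 := by
  have hz : ∀ t : ℝ, 1 < |t| → deriv cutoff t = 0 := by
    intro t ht
    have : cutoff =ᶠ[𝓝 t] fun _ => 0 := by
      filter_upwards [(isOpen_lt continuous_const continuous_abs).mem_nhds ht] with s hs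
      exact cutoff_eq_zero (le_of_lt hs)
    rw [this.deriv_eq]; simp
  have hz' : ∀ t : ℝ, 1 < |t| → cutoff'' t = 0 := by
    intro t ht
    have : deriv cutoff =ᶠ[𝓝 t] fun _ => 0 := by
      filter_upwards [(isOpen_lt continuous_const continuous_abs).mem_nhds ht] with s hs
      exact hz s hs
    rw [cutoff'', this.deriv_eq]; simp
  -- The endpoint `2` is strictly beyond the support, so no boundary term survives there in the
  -- integration by parts.
  have h1 : ∫ t, max t 0 * cutoff'' t = ∫ t in (0:ℝ)..2, t * cutoff'' t := by
    rw [intervalIntegral.integral_of_le (by norm_num)]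
    rw [← setIntegral_eq_integral_of_forall_compl_eq_zero (s := Ioc (0:ℝ) 2)]
    · refine setIntegral_congr_fun measurableSet_Ioc fun t ht => ?_
      rw [max_eq_left ht.1.le]
    · intro t ht
      rcases le_or_gt t 0 with h | h
      · simp [max_eq_right h]
      · have : 2 < t := by
          by_contra h'
          exact ht ⟨h, not_lt.1 h'⟩
        rw [hz' t (by rw [abs_of_pos h]; linarith), mul_zero]
  have h2 := intervalIntegral.integral_mul_deriv_eq_deriv_mul (a := (0:ℝ)) (b := 2)
    (u := fun t => t) (v := deriv cutoff) (u' := fun _ => 1) (v' := cutoff'')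
    (fun t _ => hasDerivAt_id t)
    (fun t _ => ((deriv_cutoff_contDiff.differentiable (by simp)) t).hasDerivAt)
    (by simp) (cutoff''_continuous.intervalIntegrable _ _)
  have h3 : ∫ t in (0:ℝ)..2, deriv cutoff t = cutoff 2 - cutoff 0 :=
    intervalIntegral.integral_deriv_eq_sub
      (fun t _ => (cutoff_contDiff.differentiable (by simp)) t)
      (deriv_cutoff_contDiff.continuous.intervalIntegrable _ _)
  rw [h1, h2, hz 2 (by norm_num)]
  simp only [one_mul]
  rw [h3, cutoff_eq_zero (by norm_num), cutoff_zero]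
  norm_num

/-! ### Product bumps: derivatives, support and exact integrals -/

/-- The product of functions of the rescaled coordinates centred at `z`. -/
def prodFn (b : OrthonormalBasis (Fin d) ℝ (E d)) (z : E d) (ρ : ℝ) (F : Fin d → ℝ → ℝ)
    (x : E d) : ℝ := ∏ j, F j (ρ⁻¹ * inner ℝ (b j) (x - z))

/-- Translation, dilation (Jacobian `ρ ^ d`), rotation of `b` to the standard basis, then Fubini. -/
lemma integral_prodFn (b : OrthonormalBasis (Fin d) ℝ (E d)) (z : E d) {ρ : ℝ} (hρ : 0 < ρ)
    (F : Fin d → ℝ → ℝ) : ∫ x, prodFn b z ρ F x = ρ ^ d * ∏ j, ∫ t, F j t := by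
  have h1 : ∫ x, prodFn b z ρ F x = ∫ x, ∏ j, F j (ρ⁻¹ * inner ℝ (b j) x) :=
    integral_sub_right_eq_self (fun x => ∏ j, F j (ρ⁻¹ * inner ℝ (b j) x)) z
  have h2 : ∫ x, ∏ j, F j (ρ⁻¹ * inner ℝ (b j) x)
      = ρ ^ d * ∫ x, ∏ j, F j (inner ℝ (b j) x) := by
    have := Measure.integral_comp_smul (volume : Measure (E d))
      (fun x => ∏ j, F j (inner ℝ (b j) x)) ρ⁻¹
    simp only [inner_smul_right, finrank_euclideanSpace, Fintype.card_fin] at this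
    rw [this, inv_pow, inv_inv, abs_of_pos (pow_pos hρ d), smul_eq_mul]
  have h3 : ∫ x, ∏ j, F j (inner ℝ (b j) x) = ∏ j, ∫ t, F j t := by
    have e1 : ∫ x, ∏ j, F j (inner ℝ (b j) x) = ∫ x : E d, ∏ j, F j (x j) := by
      rw [← b.measurePreserving_repr.integral_comp
        b.repr.toHomeomorph.measurableEmbedding (fun x : E d => ∏ j, F j (x j))]
      simp only [b.repr_apply_apply]
    rw [e1, ← (PiLp.volume_preserving_toLp (Fin d)).integral_comp
      (MeasurableEquiv.toLp 2 (Fin d → ℝ)).measurableEmbedding (fun x : E d => ∏ j, F j (x j))]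
    exact integral_fintype_prod_volume_eq_prod F
  rw [h1, h2, h3]

lemma contDiff_prodFn (b : OrthonormalBasis (Fin d) ℝ (E d)) (z : E d) (ρ : ℝ)
    {F : Fin d → ℝ → ℝ} (hF : ∀ j, ContDiff ℝ ∞ (F j)) : ContDiff ℝ ∞ (prodFn b z ρ F) := by
  unfold prodFn
  refine contDiff_prod fun j _ => (hF j).comp ?_
  exact contDiff_const.mul (contDiff_const.inner ℝ (contDiff_id.sub contDiff_const))

/-- Moving along `b i` changes only the `i`-th rescaled coordinate. Writing the result with
`Function.update` keeps it a `prodFn`, so that the lemma can be applied again for second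
derivatives. -/
lemma fderiv_prodFn (b : OrthonormalBasis (Fin d) ℝ (E d)) (z : E d) (ρ : ℝ)
    {F : Fin d → ℝ → ℝ} (hF : ∀ j, ContDiff ℝ ∞ (F j)) (i : Fin d) (x : E d) :
    fderiv ℝ (prodFn b z ρ F) x (b i)
      = ρ⁻¹ * prodFn b z ρ (Function.update F i (deriv (F i))) x := by
  have hd : DifferentiableAt ℝ (prodFn b z ρ F) x :=
    ((contDiff_prodFn b z ρ hF).differentiable (by simp)) x
  rw [← hd.lineDeriv_eq_fderiv]
  refine HasLineDerivAt.lineDeriv ?_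
  unfold HasLineDerivAt
  have hsplit : ∀ (H : Fin d → ℝ → ℝ) (y : E d), prodFn b z ρ H y =
      H i (ρ⁻¹ * inner ℝ (b i) (y - z)) *
        ∏ j ∈ Finset.univ.erase i, H j (ρ⁻¹ * inner ℝ (b j) (y - z)) := fun H y =>
    (Finset.mul_prod_erase _ _ (Finset.mem_univ i)).symm
  have hi : ∀ t : ℝ, inner ℝ (b i) (x + t • b i - z) = inner ℝ (b i) (x - z) + t := by
    intro t
    rw [show x + t • b i - z = (x - z) + t • b i by abel, inner_add_right, inner_smul_right,
      real_inner_self_eq_norm_sq, b.norm_eq_one]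
    ring
  have hj : ∀ t : ℝ, ∀ j ∈ Finset.univ.erase i,
      inner ℝ (b j) (x + t • b i - z) = inner ℝ (b j) (x - z) := by
    intro t j hj
    rw [show x + t • b i - z = (x - z) + t • b i by abel, inner_add_right, inner_smul_right,
      b.inner_eq_zero (Finset.ne_of_mem_erase hj)]
    ring
  have hfun : (fun t : ℝ => prodFn b z ρ F (x + t • b i)) = fun t =>
      F i (ρ⁻¹ * (inner ℝ (b i) (x - z) + t)) *
        ∏ j ∈ Finset.univ.erase i, F j (ρ⁻¹ * inner ℝ (b j) (x - z)) := by
    ext t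
    rw [hsplit F, hi t]
    congr 1
    exact Finset.prod_congr rfl fun j h => by rw [hj t j h]
  rw [hfun, hsplit]
  have hup : ∏ j ∈ Finset.univ.erase i,
      Function.update F i (deriv (F i)) j (ρ⁻¹ * inner ℝ (b j) (x - z))
      = ∏ j ∈ Finset.univ.erase i, F j (ρ⁻¹ * inner ℝ (b j) (x - z)) :=
    Finset.prod_congr rfl fun j h => by rw [Function.update_of_ne (Finset.ne_of_mem_erase h)]
  rw [hup, Function.update_self]
  have hin : HasDerivAt (fun t : ℝ => ρ⁻¹ * (inner ℝ (b i) (x - z) + t)) ρ⁻¹ 0 := by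
    simpa using ((hasDerivAt_id (0 : ℝ)).const_add (inner ℝ (b i) (x - z))).const_mul ρ⁻¹
  have hFi : HasDerivAt (F i) (deriv (F i) (ρ⁻¹ * inner ℝ (b i) (x - z)))
      (ρ⁻¹ * (inner ℝ (b i) (x - z) + 0)) := by
    rw [add_zero]
    exact (((hF i).differentiable (by simp)) _).hasDerivAt
  exact ((hFi.comp (0:ℝ) hin).mul_const _).congr_deriv (by ring)

/-- The product bump centred at `z` with scale `ρ`. -/
def bump (b : OrthonormalBasis (Fin d) ℝ (E d)) (z : E d) (ρ : ℝ) : E d → ℝ :=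
  prodFn b z ρ fun _ => cutoff

lemma contDiff_bump (b : OrthonormalBasis (Fin d) ℝ (E d)) (z : E d) (ρ : ℝ) :
    ContDiff ℝ ∞ (bump b z ρ) := contDiff_prodFn b z ρ fun _ => cutoff_contDiff

lemma lap_bump (b : OrthonormalBasis (Fin d) ℝ (E d)) (z : E d) (ρ : ℝ) (x : E d) :
    lap b (bump b z ρ) x =
      (ρ⁻¹) ^ 2 * ∑ i, prodFn b z ρ (Function.update (fun _ => cutoff) i cutoff'') x := by
  simp only [lap, bump]
  rw [Finset.mul_sum]
  refine Finset.sum_congr rfl fun i _ => ?_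
  have h1 : (fun y => fderiv ℝ (prodFn b z ρ fun _ => cutoff) y (b i)) = fun y =>
      ρ⁻¹ * prodFn b z ρ (Function.update (fun _ => cutoff) i (deriv cutoff)) y := by
    ext y
    exact fderiv_prodFn b z ρ (fun _ => cutoff_contDiff) i y
  have hF : ∀ j, ContDiff ℝ ∞ (Function.update (fun _ : Fin d => (cutoff : ℝ → ℝ)) i
      (deriv cutoff) j) := by
    intro j
    by_cases h : j = i
    · subst h; rw [Function.update_self]; exact deriv_cutoff_contDiff
    · rw [Function.update_of_ne h]; exact cutoff_contDiff
  have hd : DifferentiableAt ℝ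
      (prodFn b z ρ (Function.update (fun _ => cutoff) i (deriv cutoff))) x :=
    ((contDiff_prodFn b z ρ hF).differentiable (by simp)) x
  rw [h1, fderiv_const_mul hd, smul_apply, fderiv_prodFn b z ρ hF,
    Function.update_idem, Function.update_self, smul_eq_mul, ← mul_assoc, sq]
  rfl

lemma bump_nonneg (b : OrthonormalBasis (Fin d) ℝ (E d)) (z : E d) (ρ : ℝ) (x : E d) :
    0 ≤ bump b z ρ x := by
  unfold bump prodFn
  exact Finset.prod_nonneg fun _ _ => cutoff.nonneg

lemma bump_le_one (b : OrthonormalBasis (Fin d) ℝ (E d)) (z : E d) (ρ : ℝ) (x : E d) :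
    bump b z ρ x ≤ 1 := by
  unfold bump prodFn
  exact Finset.prod_le_one (fun _ _ => cutoff.nonneg) fun _ _ => cutoff.le_one

lemma abs_bump_le_one (b : OrthonormalBasis (Fin d) ℝ (E d)) (z : E d) (ρ : ℝ) (x : E d) :
    |bump b z ρ x| ≤ 1 := by
  rw [abs_of_nonneg (bump_nonneg b z ρ x)]; exact bump_le_one b z ρ x

lemma abs_lap_bump_le {L : ℝ} (hL0 : 0 ≤ L) (hL : ∀ t, |cutoff'' t| ≤ L)
    (b : OrthonormalBasis (Fin d) ℝ (E d)) (z : E d) (ρ : ℝ) (x : E d) :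
    |lap b (bump b z ρ) x| ≤ (ρ⁻¹) ^ 2 * (d * L) := by
  rw [lap_bump, abs_mul, abs_of_nonneg (sq_nonneg ρ⁻¹)]
  refine mul_le_mul_of_nonneg_left ?_ (sq_nonneg _)
  refine (Finset.abs_sum_le_sum_abs _ _).trans ?_
  refine (Finset.sum_le_card_nsmul Finset.univ _ L fun i _ => ?_).trans (by simp)
  unfold prodFn
  rw [← Finset.mul_prod_erase _ _ (Finset.mem_univ i), abs_mul, Function.update_self]
  rw [← mul_one L]
  refine mul_le_mul (hL _) ?_ (abs_nonneg _) hL0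
  rw [Finset.abs_prod]
  refine Finset.prod_le_one (fun _ _ => abs_nonneg _) fun j hj => ?_
  rw [Function.update_of_ne (Finset.ne_of_mem_erase hj), abs_of_nonneg cutoff.nonneg]
  exact cutoff.le_one

lemma norm_le_sum_inner (b : OrthonormalBasis (Fin d) ℝ (E d)) (v : E d) :
    ‖v‖ ≤ ∑ i, |inner ℝ (b i) v| := by
  conv_lhs => rw [← b.sum_repr' v]
  refine (norm_sum_le _ _).trans (Finset.sum_le_sum fun i _ => ?_)
  rw [norm_smul, b.norm_eq_one, mul_one, Real.norm_eq_abs]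

/-- The support is in a cube of half side `ρ` along the axes of `b`; the triangle inequality puts
the cube in a ball of radius `d * ρ`. This crude factor `d` enters every choice of `ρ` below. -/
lemma bump_eq_zero (b : OrthonormalBasis (Fin d) ℝ (E d)) {z : E d} {ρ : ℝ} (hρ : 0 < ρ) {x : E d}
    (hx : x ∉ Metric.closedBall z (d * ρ)) : bump b z ρ x = 0 := by
  by_contra h
  have h1 : ∀ i, |inner ℝ (b i) (x - z)| ≤ ρ := by
    intro i
    by_contra h2
    refine h (Finset.prod_eq_zero (Finset.mem_univ i) (cutoff_eq_zero ?_))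
    rw [abs_mul, abs_of_pos (inv_pos.2 hρ), inv_mul_eq_div, le_div_iff₀ hρ]
    linarith
  apply hx
  rw [Metric.mem_closedBall, dist_eq_norm]
  refine (norm_le_sum_inner b _).trans ?_
  refine (Finset.sum_le_card_nsmul Finset.univ _ ρ fun i _ => h1 i).trans (by simp)

lemma tsupport_bump_subset (b : OrthonormalBasis (Fin d) ℝ (E d)) (z : E d) {ρ : ℝ}
    (hρ : 0 < ρ) : tsupport (bump b z ρ) ⊆ Metric.closedBall z (d * ρ) :=
  closure_minimal (fun _ hx => by_contra fun h => hx (bump_eq_zero b hρ h))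
    Metric.isClosed_closedBall

lemma isTest_bump (b : OrthonormalBasis (Fin d) ℝ (E d)) {z : E d} {ρ : ℝ} (hρ : 0 < ρ)
    (h : Metric.closedBall z (d * ρ) ⊆ Ω) : IsTest Ω (bump b z ρ) :=
  ⟨contDiff_bump b z ρ,
    (isCompact_closedBall z (d * ρ)).of_isClosed_subset (isClosed_tsupport _)
      (tsupport_bump_subset b z hρ), (tsupport_bump_subset b z hρ).trans h⟩

lemma integral_bump (b : OrthonormalBasis (Fin d) ℝ (E d)) (z : E d) {ρ : ℝ} (hρ : 0 < ρ) :
    ∫ x, bump b z ρ x = ρ ^ d * mass ^ d := by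
  rw [bump, integral_prodFn b z hρ]; simp [mass]

/-- Affine functions are averaged exactly by the (even) bump. -/
lemma integral_affine_mul_bump (b : OrthonormalBasis (Fin d) ℝ (E d)) (z : E d) {ρ : ℝ}
    (hρ : 0 < ρ) (q : E d →ᵃ[ℝ] ℝ) :
    ∫ x, q x * bump b z ρ x = q z * (ρ ^ d * mass ^ d) := by
  have ht : IsTest univ (bump b z ρ) := isTest_bump b hρ (subset_univ _)
  have hq : Continuous q := (contDiff_affine q (n := 1)).continuous
  have hi : Integrable fun x => q x * bump b z ρ x :=
    (hq.mul ht.contDiff.continuous).integrable_of_hasCompactSupport ht.compact.mul_left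
  have hi' : Integrable fun x => q z * bump b z ρ x :=
    (continuous_const.mul ht.contDiff.continuous).integrable_of_hasCompactSupport
      ht.compact.mul_left
  have h0 : ∫ x, (q x - q z) * bump b z ρ x = 0 := by
    -- The point reflection `x ↦ 2z - x` preserves the bump and reverses the sign of `q - q z`.
    have h1 := integral_sub_left_eq_self (fun x => (q x - q z) * bump b z ρ x) volume (z + z)
    have h2 : ∀ x, (q (z + z - x) - q z) * bump b z ρ (z + z - x)
        = -((q x - q z) * bump b z ρ x) := by
      intro x
      have e1 : q (z + z - x) - q z = -(q x - q z) := by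
        have a1 : q (z + z - x) - q z = q.linear ((z + z - x) - z) := (q.linearMap_vsub _ _).symm
        have a2 : q x - q z = q.linear (x - z) := (q.linearMap_vsub _ _).symm
        rw [a1, a2, ← map_neg]; congr 1; abel
      have e2 : bump b z ρ (z + z - x) = bump b z ρ x := by
        unfold bump prodFn
        refine Finset.prod_congr rfl fun j _ => ?_
        rw [show z + z - x - z = -(x - z) by abel, inner_neg_right, mul_neg]
        exact cutoff_neg _
      rw [e1, e2]; ring
    simp only [h2, integral_neg] at h1
    linarith
  rw [← integral_bump b z hρ, ← integral_const_mul, ← sub_eq_zero, ← integral_sub hi hi', ← h0]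
  exact integral_congr_ae (Eventually.of_forall fun x => by simp only; ring)

/-- The distributional Laplacian of `(b k · (x - z))₊` is the surface measure of a hyperplane
through `z`. In coordinates, the terms `i ≠ k` contain the factor `∫ cutoff'' = 0`; the term `i = k`
has one factor `1` and `d - 1` factors `mass`. -/
lemma integral_max_mul_lap_bump (b : OrthonormalBasis (Fin d) ℝ (E d)) (z : E d) {ρ : ℝ}
    (hρ : 0 < ρ) (k : Fin d) :
    ∫ x, max (inner ℝ (b k) (x - z)) 0 * lap b (bump b z ρ) x
      = ρ⁻¹ * (ρ ^ d * mass ^ (d - 1)) := by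
  classical
  let m : ℝ → ℝ := fun t => max t 0
  -- Absorbing `max t 0` into the `k`-th factor keeps every summand a product; by homogeneity of
  -- `max t 0` the factor `ρ⁻²` of the Laplacian becomes `ρ⁻¹`.
  let H : Fin d → Fin d → ℝ → ℝ := fun i j t =>
    (if j = k then m t else 1) * Function.update (fun _ => (cutoff : ℝ → ℝ)) i cutoff'' j t
  have hpt : ∀ x, max (inner ℝ (b k) (x - z)) 0 * lap b (bump b z ρ) x
      = ∑ i, ρ⁻¹ * prodFn b z ρ (H i) x := by
    intro x
    rw [lap_bump, Finset.mul_sum, Finset.mul_sum]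
    refine Finset.sum_congr rfl fun i _ => ?_
    have e : prodFn b z ρ (H i) x = max (ρ⁻¹ * inner ℝ (b k) (x - z)) 0 *
        prodFn b z ρ (Function.update (fun _ => cutoff) i cutoff'') x := by
      simp only [prodFn, H, Finset.prod_mul_distrib]
      congr 1
      simp [m]
    have e2 : max (ρ⁻¹ * inner ℝ (b k) (x - z)) 0 = ρ⁻¹ * max (inner ℝ (b k) (x - z)) 0 := by
      rw [mul_max_of_nonneg _ _ (inv_pos.2 hρ).le, mul_zero]
    rw [e, e2]; ring
  have hcont : ∀ i, Integrable (prodFn b z ρ (H i)) := by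
    intro i
    have hHc : ∀ j, Continuous (H i j) := by
      intro j
      refine Continuous.mul ?_ ?_
      · by_cases h : j = k
        · simp only [h, if_true]; exact continuous_id.max continuous_const
        · simp only [h, if_false]; exact continuous_const
      · by_cases h : j = i
        · subst h; rw [Function.update_self]; exact cutoff''_continuous
        · rw [Function.update_of_ne h]; exact cutoff_contDiff.continuous
    have hc : Continuous (prodFn b z ρ (H i)) := by
      unfold prodFn
      exact continuous_finsetProd _ fun j _ => (hHc j).comp (by fun_prop)
    refine hc.integrable_of_hasCompactSupport
      (HasCompactSupport.intro (isCompact_closedBall z (d * ρ)) fun x hx => ?_)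
    by_contra hne
    have h1 : ∀ j, |inner ℝ (b j) (x - z)| ≤ ρ := by
      intro j
      by_contra h2
      refine hne (Finset.prod_eq_zero (Finset.mem_univ j) ?_)
      have h3 : 1 < |ρ⁻¹ * inner ℝ (b j) (x - z)| := by
        rw [abs_mul, abs_of_pos (inv_pos.2 hρ), inv_mul_eq_div, lt_div_iff₀ hρ]
        linarith
      simp only [H]
      by_cases h : j = i
      · subst h
        rw [Function.update_self]
        have : cutoff'' (ρ⁻¹ * inner ℝ (b j) (x - z)) = 0 := by
          refine image_eq_zero_of_notMem_tsupport fun hmem => ?_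
          have h4 := tsupport_deriv_subset (𝕜 := ℝ) (tsupport_deriv_subset (𝕜 := ℝ) hmem)
          rw [cutoff.tsupport_eq] at h4
          simp [cutoff] at h4
          rw [abs_mul, abs_inv] at h3
          linarith
        rw [this, mul_zero]
      · rw [Function.update_of_ne h, cutoff_eq_zero h3.le, mul_zero]
    apply hx
    rw [Metric.mem_closedBall, dist_eq_norm]
    refine (norm_le_sum_inner b _).trans ?_
    exact (Finset.sum_le_card_nsmul Finset.univ _ ρ fun i _ => h1 i).trans (by simp)
  simp only [hpt]
  rw [integral_finsetSum _ fun i _ => (hcont i).const_mul _]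
  simp only [integral_const_mul, integral_prodFn b z hρ]
  rw [← Finset.mul_sum, ← Finset.mul_sum]
  congr 2
  rw [Finset.sum_eq_single k]
  · rw [← Finset.mul_prod_erase _ _ (Finset.mem_univ k)]
    have e1 : ∫ t, H k k t = 1 := by
      simp only [H, if_true, Function.update_self, m]
      exact integral_max_mul_cutoff''
    have e2 : ∀ j ∈ Finset.univ.erase k, ∫ t, H k j t = mass := by
      intro j hj
      have hjk := Finset.ne_of_mem_erase hj
      simp only [H, hjk, if_false, one_mul, Function.update_of_ne hjk, mass]
    rw [e1, Finset.prod_congr rfl e2]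
    simp
  · intro i _ hik
    refine Finset.prod_eq_zero (Finset.mem_univ i) ?_
    simp only [H, hik, if_false, one_mul, Function.update_self]
    exact integral_cutoff''
  · simp

/-! ### Geometry of simplices and of their common sides -/

/-- The gradient of an affine function. -/
def agrad (A : E d →ᵃ[ℝ] ℝ) : E d :=
  (InnerProductSpace.toDual ℝ (E d)).symm (LinearMap.toContinuousLinearMap A.linear)

lemma affine_sub (A : E d →ᵃ[ℝ] ℝ) (x y : E d) : A x - A y = inner ℝ (agrad A) (x - y) := by
  rw [agrad, InnerProductSpace.toDual_symm_apply]
  exact (A.linearMap_vsub x y).symm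

/-- The vertices of a nondegenerate simplex as an affine basis. -/
def vertexBasis {T : Finset (E d)} (hc : T.card = d + 1)
    (hi : AffineIndependent ℝ ((↑) : T → E d)) : AffineBasis T ℝ (E d) :=
  ⟨(↑), hi, by
    rw [hi.affineSpan_eq_top_iff_card_eq_finrank_add_one]
    simp [hc]⟩

section Simplex

variable {T : Finset (E d)} (hc : T.card = d + 1) (hi : AffineIndependent ℝ ((↑) : T → E d))

lemma range_vertexBasis : range (vertexBasis hc hi) = (T : Set (E d)) := Subtype.range_coe

lemma simplex_eq : simplex T = {x | ∀ i, 0 ≤ (vertexBasis hc hi).coord i x} := by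
  rw [← AffineBasis.convexHull_eq_nonneg_coord, range_vertexBasis, simplex]

lemma interior_simplex : interior (simplex T) = {x | ∀ i, 0 < (vertexBasis hc hi).coord i x} := by
  rw [← AffineBasis.interior_convexHull, range_vertexBasis, simplex]

lemma coord_self (i : T) : (vertexBasis hc hi).coord i i = 1 :=
  (vertexBasis hc hi).coord_apply_eq i

lemma coord_ne {i j : T} (h : i ≠ j) : (vertexBasis hc hi).coord i j = 0 :=
  (vertexBasis hc hi).coord_apply_ne h

lemma coord_le_one {x : E d} (hx : x ∈ simplex T) (i : T) : (vertexBasis hc hi).coord i x ≤ 1 := by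
  rw [simplex_eq hc hi] at hx
  rw [← (vertexBasis hc hi).sum_coord_apply_eq_one x]
  exact Finset.single_le_sum (fun j _ => hx j) (Finset.mem_univ i)

/-- A barycentric coordinate stays in `[0, 1]` on the simplex, so it grows by at most `1` along the
diameter, of length `2 * r`, of the inscribed ball in the direction of its gradient. -/
lemma norm_agrad_coord_le {c : E d} {r : ℝ} (hr : 0 < r)
    (hb : Metric.closedBall c r ⊆ simplex T) (i : T) :
    ‖agrad ((vertexBasis hc hi).coord i)‖ ≤ (2 * r)⁻¹ := by
  set g := agrad ((vertexBasis hc hi).coord i) with hg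
  rcases eq_or_ne g 0 with h0 | h0
  · rw [h0, norm_zero]; positivity
  have hn : 0 < ‖g‖ := norm_pos_iff.2 h0
  have hv : ‖(r / ‖g‖) • g‖ = r := by
    rw [norm_smul, Real.norm_of_nonneg (by positivity)]; field_simp
  have h1 : c + (r / ‖g‖) • g ∈ simplex T := hb (by simp [hv])
  have h2 : c - (r / ‖g‖) • g ∈ simplex T := hb (by simp [hv])
  have h3 := coord_le_one hc hi h1 i
  rw [simplex_eq hc hi] at h2
  have h4 := h2 i
  have h5 := affine_sub ((vertexBasis hc hi).coord i) (c + (r / ‖g‖) • g) (c - (r / ‖g‖) • g)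
  rw [← hg, show c + (r / ‖g‖) • g - (c - (r / ‖g‖) • g) = (2 * (r / ‖g‖)) • g by module,
    inner_smul_right, real_inner_self_eq_norm_sq] at h5
  have h6 : 2 * (r / ‖g‖) * ‖g‖ ^ 2 = ‖g‖ * (2 * r) := by field_simp
  rw [h6] at h5
  rw [← one_div, le_div_iff₀ (by positivity)]
  linarith

end Simplex

/-- The coordinate of `p` falls from `1` to `0` between `p` and `q`, and its gradient is at most `(2
* r)⁻¹`. An edge of a common side thereby compares the sizes of the two elements. -/
lemma two_mul_le_dist {T : Finset (E d)} (hc : T.card = d + 1)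
    (hi : AffineIndependent ℝ ((↑) : T → E d)) {c : E d} {r : ℝ} (hr : 0 < r)
    (hb : Metric.closedBall c r ⊆ simplex T) {p q : E d} (hp : p ∈ T) (hq : q ∈ T) (hpq : p ≠ q) :
    2 * r ≤ dist p q := by
  have h := affine_sub ((vertexBasis hc hi).coord ⟨p, hp⟩) p q
  have e1 : (vertexBasis hc hi).coord ⟨p, hp⟩ p = 1 := coord_self hc hi ⟨p, hp⟩
  have e2 : (vertexBasis hc hi).coord ⟨p, hp⟩ q = 0 :=
    coord_ne hc hi (i := ⟨p, hp⟩) (j := ⟨q, hq⟩) (by simpa using hpq)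
  rw [e1, e2] at h
  have h2 := (real_inner_le_norm (agrad ((vertexBasis hc hi).coord ⟨p, hp⟩)) (p - q)).trans
    (mul_le_mul_of_nonneg_right (norm_agrad_coord_le hc hi hr hb ⟨p, hp⟩) (norm_nonneg _))
  rw [← h, inv_mul_eq_div, le_div_iff₀ (by positivity)] at h2
  rw [dist_eq_norm]; linarith

lemma subset_simplex (T : Finset (E d)) : (T : Set (E d)) ⊆ simplex T := subset_convexHull ℝ _

lemma isCompact_simplex (T : Finset (E d)) : IsCompact (simplex T) :=
  T.finite_toSet.isCompact_convexHull ℝ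

lemma isBounded_simplex (T : Finset (E d)) : Bornology.IsBounded (simplex T) :=
  (isCompact_simplex T).isBounded

lemma convex_simplex (T : Finset (E d)) : Convex ℝ (simplex T) := convex_convexHull ℝ _

lemma dist_le_size {T : Finset (E d)} {x y : E d} (hx : x ∈ simplex T) (hy : y ∈ simplex T) :
    dist x y ≤ size T := Metric.dist_le_diam_of_mem (isBounded_simplex T) hx hy

/-- The barycentre of a side. -/
def barycentre (S : Finset (E d)) : E d := (d : ℝ)⁻¹ • ∑ p ∈ S, p

lemma affine_barycentre {S : Finset (E d)} (hS : S.card = d) (hd : 0 < d) (A : E d →ᵃ[ℝ] ℝ) :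
    A (barycentre S) = (d : ℝ)⁻¹ * ∑ p ∈ S, A p := by
  have h : ∀ x, A x = A.linear x + A 0 := fun x => congrFun A.decomp x
  have hd' : (d : ℝ) ≠ 0 := by positivity
  rw [h, barycentre, map_smul, map_sum, Finset.sum_congr rfl fun p _ => h p,
    Finset.sum_add_distrib, Finset.sum_const, hS]
  simp only [smul_eq_mul, nsmul_eq_mul]
  field_simp

/-- A side and its opposite vertex. -/
lemma exists_opposite {T S : Finset (E d)} (hc : T.card = d + 1) (hS : S.card = d) (hST : S ⊆ T) :
    ∃ o ∈ T, o ∉ S ∧ ∀ p ∈ T, p = o ∨ p ∈ S := by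
  classical
  obtain ⟨o, hoT, hoS⟩ := Finset.exists_mem_notMem_of_card_lt_card (s := S) (t := T) (by omega)
  refine ⟨o, hoT, hoS, fun p hp => ?_⟩
  have : insert o S = T := Finset.eq_of_subset_of_card_le
    (Finset.insert_subset hoT hST) (by rw [Finset.card_insert_of_notMem hoS]; omega)
  rw [← this] at hp
  simpa using hp

lemma barycentre_mem {S : Finset (E d)} (hS : S.card = d) (hd : 0 < d) :
    barycentre S ∈ simplex S := by
  rw [barycentre, Finset.smul_sum]
  refine (convex_simplex S).sum_mem (fun _ _ => by positivity) ?_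
    (fun p hp => subset_simplex S hp)
  rw [Finset.sum_const, hS, nsmul_eq_mul]
  exact mul_inv_cancel₀ (by positivity)

/-- Normals to a side: existence, uniqueness up to scaling, and the half ball in the element. -/
lemma side_half {T S : Finset (E d)} (hd : 0 < d) (hc : T.card = d + 1)
    (hi : AffineIndependent ℝ ((↑) : T → E d)) (hS : S.card = d) (hST : S ⊆ T) :
    (∃ ν, IsNormalTowards S T ν) ∧ ∀ ν, IsNormalTowards S T ν →
      (∀ w : E d, (∀ p ∈ S, ∀ q ∈ S, inner ℝ w (p - q) = 0) → w = (inner ℝ ν w : ℝ) • ν) ∧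
      ∀ (c : E d) (r : ℝ), 0 < r → Metric.closedBall c r ⊆ simplex T →
        ∀ x, d * dist x (barycentre S) ≤ 2 * r → 0 ≤ (inner ℝ ν (x - barycentre S) : ℝ) →
          x ∈ simplex T := by
  obtain ⟨o, hoT, hoS, ho⟩ := exists_opposite hc hS hST
  obtain ⟨p₀, hp₀⟩ : S.Nonempty := Finset.card_pos.1 (by omega)
  have hd' : (0 : ℝ) < d := by exact_mod_cast hd
  set B := vertexBasis hc hi with hB
  -- The gradient of the coordinate of the opposite vertex is normal to `S` and points into `T`;
  -- every normal is compared with it.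
  set g := agrad (B.coord ⟨o, hoT⟩) with hg
  have hcS : ∀ p ∈ S, B.coord ⟨o, hoT⟩ p = 0 := fun p hp =>
    coord_ne hc hi (i := ⟨o, hoT⟩) (j := ⟨p, hST hp⟩) fun h =>
      hoS (by rw [Subtype.mk.injEq] at h; rwa [h])
  have hco : B.coord ⟨o, hoT⟩ o = 1 := coord_self hc hi ⟨o, hoT⟩
  have hgS : ∀ p ∈ S, ∀ q ∈ S, inner ℝ g (p - q) = 0 := fun p hp q hq => by
    rw [hg, ← affine_sub, hcS p hp, hcS q hq, sub_zero]
  have hgo : ∀ p ∈ S, inner ℝ g (o - p) = 1 := fun p hp => by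
    rw [hg, ← affine_sub, hcS p hp, hco, sub_zero]
  have hg0 : g ≠ 0 := fun h => by simpa [h] using hgo p₀ hp₀
  have hgn : 0 < ‖g‖ := norm_pos_iff.2 hg0
  have hbc : B.coord ⟨o, hoT⟩ (barycentre S) = 0 := by
    rw [affine_barycentre hS hd, Finset.sum_eq_zero fun p hp => hcS p hp, mul_zero]
  -- The difference `v` has the same inner product with all vertices, hence with all points, since
  -- the vertices span affinely; so `v = 0`.
  have hspan : ∀ w : E d, (∀ p ∈ S, ∀ q ∈ S, inner ℝ w (p - q) = 0) →
      w = (inner ℝ w (o - p₀) : ℝ) • g := by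
    intro w hw
    rw [← sub_eq_zero]
    set v := w - (inner ℝ w (o - p₀) : ℝ) • g with hv
    have h1 : ∀ p ∈ T, inner ℝ v p = inner ℝ v p₀ := by
      intro p hp
      rw [← sub_eq_zero, ← inner_sub_right, hv, inner_sub_left, inner_smul_left]
      rcases ho p hp with rfl | hpS
      · simp [hgo p₀ hp₀]
      · simp [hgS p hpS p₀ hp₀, hw p hpS p₀ hp₀]
    have h2 : ∀ x, inner ℝ v x = inner ℝ v p₀ := by
      intro x
      conv_lhs => rw [← B.linear_combination_coord_eq_self x]
      rw [inner_sum]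
      have : ∀ i : T, inner ℝ v (B.coord i x • B i) = B.coord i x * inner ℝ v p₀ := fun i => by
        rw [inner_smul_right]; congr 1; exact h1 i i.2
      rw [Finset.sum_congr rfl fun i _ => this i, ← Finset.sum_mul, B.sum_coord_apply_eq_one,
        one_mul]
    have h3 := h2 (p₀ + v)
    rw [inner_add_right, add_eq_left] at h3
    exact inner_self_eq_zero.1 h3
  refine ⟨⟨‖g‖⁻¹ • g, ?_, ?_, ?_⟩, ?_⟩
  · rw [norm_smul, norm_inv, norm_norm, inv_mul_cancel₀ hgn.ne']
  · intro p hp q hq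
    rw [inner_smul_left, hgS p hp q hq, mul_zero]
  · intro p hp x hx
    rw [inner_smul_left]
    refine mul_nonneg (by simp) ?_
    rcases ho x hx with rfl | hxS
    · rw [hgo p hp]; exact zero_le_one
    · rw [hgS x hxS p hp]
  · rintro ν ⟨hν1, hν2, hν3⟩
    set α : ℝ := inner ℝ ν (o - p₀) with hα
    have hνg : ν = α • g := hspan ν hν2
    have hα0 : 0 < α := by
      refine lt_of_le_of_ne (hν3 p₀ hp₀ o hoT) fun h => ?_
      rw [← h, zero_smul] at hνg
      rw [hνg, norm_zero] at hν1
      exact zero_ne_one hν1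
    have hgν : g = α⁻¹ • ν := by rw [hνg, smul_smul, inv_mul_cancel₀ hα0.ne', one_smul]
    refine ⟨fun w hw => ?_, fun c r hr hb x hx hx0 => ?_⟩
    · have h := hspan w hw
      set β : ℝ := inner ℝ w (o - p₀)
      rw [hgν, smul_smul] at h
      have h' : inner ℝ ν w = β * α⁻¹ := by
        rw [h, inner_smul_right, real_inner_self_eq_norm_sq, hν1]; ring
      rw [h', ← h]
    -- The coordinate of the opposite vertex is a nonnegative multiple of `ν · (x - barycentre S)`.
    -- The others equal `1 / d` at the barycentre and change by at most `(2 * r)⁻¹ * dist x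
    -- (barycentre S) ≤ 1 / d`.
    · rw [simplex_eq hc hi]
      rintro ⟨p, hp⟩
      rcases ho p hp with rfl | hpS
      · have h1 := affine_sub (B.coord ⟨p, hp⟩) x (barycentre S)
        rw [hbc, sub_zero, ← hg, hgν, inner_smul_left] at h1
        rw [← hB, h1]
        exact mul_nonneg (by simpa using hα0.le) hx0
      · have hb1 : B.coord ⟨p, hp⟩ (barycentre S) = (d : ℝ)⁻¹ := by
          rw [affine_barycentre hS hd, Finset.sum_eq_single p]
          · rw [coord_self hc hi ⟨p, hp⟩, mul_one]
          · intro q hq hqp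
            exact coord_ne hc hi (i := ⟨p, hp⟩) (j := ⟨q, hST hq⟩) (by simpa using hqp.symm)
          · exact fun h => absurd hpS h
        have h1 := affine_sub (B.coord ⟨p, hp⟩) x (barycentre S)
        have h2 := (abs_real_inner_le_norm (agrad (B.coord ⟨p, hp⟩)) (x - barycentre S)).trans
          (mul_le_mul_of_nonneg_right (norm_agrad_coord_le hc hi hr hb ⟨p, hp⟩) (norm_nonneg _))
        rw [← h1, hb1, ← dist_eq_norm] at h2
        have h3 : (2 * r)⁻¹ * dist x (barycentre S) ≤ (d : ℝ)⁻¹ := by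
          rw [inv_mul_eq_div, div_le_iff₀ (by positivity), inv_mul_eq_div, le_div_iff₀ hd']
          linarith
        have h4 := (abs_le.1 (h2.trans h3)).1
        change 0 ≤ B.coord ⟨p, hp⟩ x
        linarith

lemma inter_eq_side {T T' S : Finset (E d)} (hc : T.card = d + 1) (hc' : T'.card = d + 1)
    (hne : T' ≠ T) (hS : S.card = d) (hST : S ⊆ T) (hST' : S ⊆ T') :
    (T : Set (E d)) ∩ T' = S := by
  classical
  have h1 : (T ∩ T').card ≤ d := by
    by_contra h
    have h2 : T ∩ T' = T := Finset.eq_of_subset_of_card_le Finset.inter_subset_left (by omega)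
    have h3 : T ∩ T' = T' := Finset.eq_of_subset_of_card_le Finset.inter_subset_right (by omega)
    exact hne (h3.symm.trans h2)
  have : S = T ∩ T' := Finset.eq_of_subset_of_card_le (Finset.subset_inter hST hST') (by omega)
  rw [← Finset.coe_inter, ← this]

/-- The two sides of an internal side of the mesh. -/
lemma Mesh.side_geometry (M : Mesh Ω) (hd : 0 < d) {T T' S : Finset (E d)} (hT : T ∈ M.elems)
    (hT' : T' ∈ M.elems) (hne : T' ≠ T) (hS : S.card = d) (hST : S ⊆ T) (hST' : S ⊆ T')
    {c c' : E d} {r r' : ℝ} (hr : 0 < r) (hb : Metric.closedBall c r ⊆ simplex T)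
    (hr' : 0 < r') (hb' : Metric.closedBall c' r' ⊆ simplex T') :
    ∃ ν : E d, ‖ν‖ = 1 ∧ normalTowards S T = ν ∧ normalTowards S T' = -ν ∧
      (∀ w : E d, (∀ p ∈ S, ∀ q ∈ S, inner ℝ w (p - q) = 0) → w = (inner ℝ ν w : ℝ) • ν) ∧
      ∀ x, d * dist x (barycentre S) ≤ 2 * min r r' →
        (0 ≤ (inner ℝ ν (x - barycentre S) : ℝ) → x ∈ simplex T) ∧
        ((inner ℝ ν (x - barycentre S) : ℝ) ≤ 0 → x ∈ simplex T') := by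
  have hd' : (0 : ℝ) < d := by exact_mod_cast hd
  obtain ⟨hex, h⟩ := side_half hd (M.card_eq T hT) (M.indep T hT) hS hST
  obtain ⟨hex', h'⟩ := side_half hd (M.card_eq T' hT') (M.indep T' hT') hS hST'
  have hν : IsNormalTowards S T (normalTowards S T) := Classical.epsilon_spec hex
  have hν' : IsNormalTowards S T' (normalTowards S T') := Classical.epsilon_spec hex'
  set ν := normalTowards S T
  set ν' := normalTowards S T'
  obtain ⟨h1, h2⟩ := h ν hν
  obtain ⟨-, h2'⟩ := h' ν' hν'
  have hinter := inter_eq_side (M.card_eq T hT) (M.card_eq T' hT') hne hS hST hST'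
  -- By conformity a common point lies in the simplex spanned by `S`, hence in the hyperplane of
  -- `S`.
  have hflat : ∀ x ∈ simplex T ∩ simplex T', inner ℝ ν (x - barycentre S) = 0 := by
    intro x hx
    rw [M.conforming T hT T' hT', hinter] at hx
    obtain ⟨p₀, hp₀⟩ : S.Nonempty := Finset.card_pos.1 (by omega)
    have hconv : Convex ℝ {x : E d | inner ℝ ν x = inner ℝ ν p₀} :=
      convex_hyperplane (innerₗ (E d) ν).isLinear _
    have hsub : simplex S ⊆ {x : E d | inner ℝ ν x = inner ℝ ν p₀} := by
      refine convexHull_min (fun p hp => ?_) hconv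
      have := hν.2.1 p hp p₀ hp₀
      rwa [inner_sub_right, sub_eq_zero] at this
    have e1 : inner ℝ ν x = inner ℝ ν p₀ := hsub hx
    have e2 : inner ℝ ν (barycentre S) = inner ℝ ν p₀ := hsub (barycentre_mem hS hd)
    rw [inner_sub_right, e1, e2, sub_self]
  have hsgn : ν' = -ν := by
    have e := h1 ν' hν'.2.1
    set t : ℝ := inner ℝ ν ν'
    have hn : |t| = 1 := by
      have := hν'.1
      rwa [e, norm_smul, hν.1, mul_one, Real.norm_eq_abs] at this
    rcases (abs_eq zero_le_one).1 hn with ht | ht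
    -- If both normals agreed, the point at distance `s` from the barycentre along `ν` would belong
    -- to both elements but not to the hyperplane of `S`.
    · exfalso
      rw [ht, one_smul] at e
      set s : ℝ := 2 * min r r' / d with hs
      have hs0 : 0 < s := by have := lt_min hr hr'; positivity
      have hds : d * dist (barycentre S + s • ν) (barycentre S) = 2 * min r r' := by
        rw [dist_eq_norm, add_sub_cancel_left, norm_smul, hν.1, Real.norm_of_nonneg hs0.le, hs]
        field_simp
      have hin : (inner ℝ ν (barycentre S + s • ν - barycentre S) : ℝ) = s := by
        rw [add_sub_cancel_left, inner_smul_right, real_inner_self_eq_norm_sq, hν.1]; ring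
      have m1 := h2 c r hr hb (barycentre S + s • ν)
        (by rw [hds]; linarith [min_le_left r r']) (by rw [hin]; exact hs0.le)
      have m2 := h2' c' r' hr' hb' (barycentre S + s • ν)
        (by rw [hds]; linarith [min_le_right r r']) (by rw [e, hin]; exact hs0.le)
      have := hflat _ ⟨m1, m2⟩
      rw [hin] at this
      exact hs0.ne' this
    · rw [e, ht, neg_one_smul]
  refine ⟨ν, hν.1, rfl, hsgn, h1, fun x hx => ⟨fun h0 => ?_, fun h0 => ?_⟩⟩
  · exact h2 c r hr hb x (by linarith [min_le_left r r']) h0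
  · refine h2' c' r' hr' hb' x (by linarith [min_le_right r r']) ?_
    rw [hsgn, inner_neg_left]; linarith

/-! ### Elements inside the domain, null sets, and the piecewise affine projection -/

lemma HasLipschitzBoundary.interior_closure_subset (h : HasLipschitzBoundary Ω) :
    interior (closure Ω) ⊆ Ω := by
  intro x hx
  by_contra hxΩ
  have hfr : x ∈ frontier Ω := ⟨interior_subset hx, fun h' => hxΩ (interior_subset h')⟩
  obtain ⟨e, φ, K, r, he, hφ, hinv, hr, hloc⟩ := h x hfr
  have h1 : inner ℝ e x ≤ φ x := by
    by_contra h'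
    exact hxΩ ((hloc x (Metric.mem_ball_self hr)).2 (not_le.1 h'))
  -- Being on or below the graph, `x` can be moved slightly along `-e` to a point strictly below it
  -- and still in `closure Ω`. Near that point there is nothing of `Ω`, a contradiction. Thus `Ω`
  -- has no slits, and open sets covered by elements lie in `Ω` itself.
  have hcont : Continuous fun t : ℝ => x + t • e := by fun_prop
  have hev : ∀ᶠ t in 𝓝 (0 : ℝ), x + t • e ∈ interior (closure Ω) ∩ Metric.ball x r := by
    refine hcont.continuousAt.preimage_mem_nhds ?_
    rw [zero_smul, add_zero]
    exact inter_mem (isOpen_interior.mem_nhds hx) (Metric.ball_mem_nhds x hr)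
  obtain ⟨ε, hε, hball⟩ := Metric.eventually_nhds_iff.1 hev
  have ht := hball (y := -(ε / 2)) (by rw [dist_zero_right, norm_neg, Real.norm_of_nonneg] <;> linarith)
  set y := x + (-(ε / 2)) • e with hy
  have hU : IsOpen ({z : E d | inner ℝ e z < φ z} ∩ Metric.ball x r) :=
    (isOpen_lt (by fun_prop) hφ.continuous).inter Metric.isOpen_ball
  have hyU : y ∈ {z : E d | inner ℝ e z < φ z} ∩ Metric.ball x r := by
    refine ⟨?_, ht.2⟩
    simp only [mem_ofPred_eq]
    rw [hy, hinv, inner_add_right, inner_smul_right, real_inner_self_eq_norm_sq, he]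
    linarith
  obtain ⟨z, ⟨hz1, hz2⟩, hzΩ⟩ := mem_closure_iff.1 (interior_subset ht.1) _ hU hyU
  exact lt_asymm hz1 ((hloc z hz2).1 hzΩ)

lemma Mesh.simplex_subset (M : Mesh Ω) {T : Finset (E d)} (hT : T ∈ M.elems) :
    simplex T ⊆ closure Ω := by
  rw [← M.cover]
  exact subset_biUnion_of_mem (u := fun T => simplex T) hT

lemma Mesh.interior_simplex_subset (M : Mesh Ω) (hL : HasLipschitzBoundary Ω)
    {T : Finset (E d)} (hT : T ∈ M.elems) : interior (simplex T) ⊆ Ω :=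
  (interior_mono (M.simplex_subset hT)).trans hL.interior_closure_subset

/-- The frontier of a convex set is null. Norms are taken over closed elements, which may touch
`∂Ω`, while only their interiors are known to lie in `Ω`. -/
lemma interior_ae_eq_simplex (T : Finset (E d)) :
    interior (simplex T) =ᵐ[volume] simplex T :=
  interior_ae_eq_of_null_frontier ((convex_simplex T).addHaar_frontier volume)

lemma Mesh.region_ae_subset (M : Mesh Ω) (hL : HasLipschitzBoundary Ω)
    {N : Finset (Finset (E d))} (hN : N ⊆ M.elems) : region N ≤ᵐ[volume] Ω := by
  have h : ∀ T ∈ N, simplex T ≤ᵐ[volume] Ω := fun T hT =>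
    (interior_ae_eq_simplex T).symm.le.trans
      (LE.le.eventuallyLE (M.interior_simplex_subset hL (hN hT)))
  have h2 : ∀ᵐ x ∂(volume : Measure (E d)), ∀ T ∈ N, x ∈ simplex T → x ∈ Ω :=
    (Finset.eventually_all N).2 h
  filter_upwards [h2] with x hx hxN
  obtain ⟨T, hT, hxT⟩ := mem_iUnion₂.1 hxN
  exact hx T hT hxT

/-- Different elements have disjoint interiors. -/
lemma Mesh.disjoint_interior (M : Mesh Ω) {T T' : Finset (E d)} (hT : T ∈ M.elems)
    (hT' : T' ∈ M.elems) (hne : T ≠ T') : Disjoint (interior (simplex T)) (interior (simplex T')) := by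
  rw [Set.disjoint_iff]
  rintro x ⟨hx, hx'⟩
  obtain ⟨p, hp, hp'⟩ : ∃ p ∈ T, p ∉ T' := by
    by_contra! h
    exact hne (Finset.eq_of_subset_of_card_le h (by rw [M.card_eq T hT, M.card_eq T' hT']))
  have hx2 : x ∈ convexHull ℝ ((T : Set (E d)) ∩ T') := by
    rw [← M.conforming T hT T' hT']
    exact ⟨interior_subset hx, interior_subset hx'⟩
  rw [interior_simplex (M.card_eq T hT) (M.indep T hT)] at hx
  have hpos := hx ⟨p, hp⟩
  -- The coordinate of a vertex not shared by `T'` is positive in the interior of `T` and zero on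
  -- the common face.
  set f := (vertexBasis (M.card_eq T hT) (M.indep T hT)).coord ⟨p, hp⟩
  have hconv : Convex ℝ (f ⁻¹' {0}) := (convex_singleton (0 : ℝ)).affine_preimage f
  have hsub : convexHull ℝ ((T : Set (E d)) ∩ T') ⊆ f ⁻¹' {0} := by
    refine convexHull_min (fun q hq => ?_) hconv
    refine coord_ne _ _ (i := ⟨p, hp⟩) (j := ⟨q, hq.1⟩) fun h => hp' ?_
    rw [Subtype.mk.injEq] at h
    rw [h]; exact hq.2
  have h0 : f x = 0 := hsub hx2
  exact hpos.ne' h0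

lemma continuous_affine (A : E d →ᵃ[ℝ] ℝ) : Continuous A :=
  (contDiff_affine A (n := 1)).continuous

lemma memLp_of_continuous_bounded {g : E d → ℝ} (hg : Continuous g) {s : Set (E d)}
    (hs : Bornology.IsBounded s) {p : ℝ≥0∞} : MemLp g p (volume.restrict s) := by
  obtain ⟨C, hC⟩ := hs.isCompact_closure.exists_bound_of_continuousOn hg.continuousOn
  have : IsFiniteMeasure (volume.restrict (closure s)) :=
    ⟨by simpa using hs.isCompact_closure.measure_lt_top⟩
  have h1 : MemLp g p (volume.restrict (closure s)) :=
    MemLp.of_bound hg.aestronglyMeasurable C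
      ((ae_restrict_iff' isClosed_closure.measurableSet).2 (Eventually.of_forall hC))
  exact h1.mono_measure (Measure.restrict_mono subset_closure le_rfl)

lemma memLp_affine (A : E d →ᵃ[ℝ] ℝ) {s : Set (E d)} (hs : Bornology.IsBounded s) {p : ℝ≥0∞} :
    MemLp A p (volume.restrict s) := memLp_of_continuous_bounded (continuous_affine A) hs

/-- The affine functions in `L^2(s)`. -/
def affineToLp {s : Set (E d)} (hs : Bornology.IsBounded s) :
    (E d × ℝ) →ₗ[ℝ] Lp ℝ 2 (volume.restrict s) where
  toFun w := (memLp_of_continuous_bounded (g := fun x => inner ℝ w.1 x + w.2)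
    (by fun_prop) hs).toLp _
  map_add' v w := by
    rw [← MemLp.toLp_add]
    refine MemLp.toLp_congr _ _ (Eventually.of_forall fun x => ?_)
    simp only [Prod.fst_add, Prod.snd_add, Pi.add_apply, inner_add_left]
    ring
  map_smul' c w := by
    rw [RingHom.id_apply, ← MemLp.toLp_const_smul]
    refine MemLp.toLp_congr _ _ (Eventually.of_forall fun x => ?_)
    simp only [Prod.smul_fst, Prod.smul_snd, Pi.smul_apply, inner_smul_left, smul_eq_mul]
    simp
    ring

lemma affine_eq (A : E d →ᵃ[ℝ] ℝ) (x : E d) : A x = inner ℝ (agrad A) x + A 0 := by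
  have := affine_sub A x 0
  rw [sub_zero] at this
  linarith

/-- Affine functions, parametrised by gradient and constant term, form a finite-dimensional subspace
of `L²`, which has an orthogonal projection. -/
lemma exists_affine_proj {s : Set (E d)} (hs : Bornology.IsBounded s) {g : E d → ℝ}
    (hg : MemLp g 2 (volume.restrict s)) :
    ∃ A : E d →ᵃ[ℝ] ℝ, ∀ B : E d →ᵃ[ℝ] ℝ, ∫ x in s, (g x - A x) * B x = 0 := by
  obtain ⟨u, ⟨w, hw⟩, z, hz, huz⟩ :=
    (LinearMap.range (affineToLp hs)).exists_add_mem_mem_orthogonal (hg.toLp g)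
  refine ⟨((innerₗ (E d) w.1).toAffineMap + AffineMap.const ℝ (E d) w.2), fun B => ?_⟩
  have h1 := (Submodule.mem_orthogonal _ _).1 hz (affineToLp hs (agrad B, B 0)) ⟨_, rfl⟩
  have hz' : z = hg.toLp g - affineToLp hs w := by rw [hw, huz]; abel
  rw [L2.inner_def] at h1
  rw [← h1]
  refine integral_congr_ae ?_
  have e1 := (memLp_of_continuous_bounded (p := 2) (g := fun x => inner ℝ w.1 x + w.2)
    (by fun_prop) hs).coeFn_toLp
  have e2 := (memLp_of_continuous_bounded (p := 2) (g := fun x => inner ℝ (agrad B) x + B 0)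
    (by fun_prop) hs).coeFn_toLp
  rw [hz']
  filter_upwards [e1, e2, hg.coeFn_toLp, Lp.coeFn_sub (hg.toLp g) (affineToLp hs w)]
    with x h1 h2 h3 h4
  have h2' : (affineToLp hs (agrad B, B 0)) x = inner ℝ (agrad B) x + B 0 := h2
  have h1' : (affineToLp hs w) x = inner ℝ w.1 x + w.2 := h1
  rw [h4, Pi.sub_apply, h2', h1', h3, affine_eq B]
  simp

lemma Mesh.ae_eq_iUnion_interior (M : Mesh Ω) (hL : HasLipschitzBoundary Ω) :
    Ω =ᵐ[volume] ⋃ T ∈ M.elems, interior (simplex T) := by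
  have h2 : ∀ᵐ x ∂(volume : Measure (E d)), ∀ T ∈ M.elems,
      x ∈ simplex T → x ∈ interior (simplex T) :=
    (Finset.eventually_all _).2 fun T _ => (interior_ae_eq_simplex T).symm.le
  refine Filter.EventuallyLE.antisymm ?_ (LE.le.eventuallyLE
    (iUnion₂_subset fun T hT => M.interior_simplex_subset hL hT))
  filter_upwards [h2] with x hx hxΩ
  have hx' : x ∈ ⋃ T ∈ M.elems, simplex T := M.cover ▸ subset_closure hxΩ
  obtain ⟨T, hT, hxT⟩ := mem_iUnion₂.1 hx'
  exact mem_iUnion₂.2 ⟨T, hT, hx T hT hxT⟩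

lemma isBounded_interior_simplex (T : Finset (E d)) :
    Bornology.IsBounded (interior (simplex T)) := (isBounded_simplex T).subset interior_subset

/-- There is no continuity condition between elements, so elementwise projections glue to the global
one. Existence is what gives the choice in `Mesh.l2Proj` its meaning. -/
lemma Mesh.exists_isL2Proj (M : Mesh Ω) (hL : HasLipschitzBoundary Ω) {g : E d → ℝ}
    (hg : MemLp g 2 (volume.restrict Ω)) : ∃ q, M.IsL2Proj g q := by
  have hg' : ∀ T ∈ M.elems, MemLp g 2 (volume.restrict (interior (simplex T))) := fun T hT =>
    hg.mono_measure (Measure.restrict_mono (M.interior_simplex_subset hL hT) le_rfl)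
  choose! A hA using fun T (hT : T ∈ M.elems) =>
    exists_affine_proj (isBounded_interior_simplex T) (hg' T hT)
  set q : E d → ℝ := fun x => ∑ T ∈ M.elems, (interior (simplex T)).indicator (A T) x with hq
  have hqT : ∀ T ∈ M.elems, ∀ x ∈ interior (simplex T), q x = A T x := by
    intro T hT x hx
    rw [hq]
    simp only
    rw [Finset.sum_eq_single T, indicator_of_mem hx]
    · intro T' hT' hne
      refine indicator_of_notMem (fun hx' => ?_) _
      exact Set.disjoint_left.1 (M.disjoint_interior hT' hT hne) hx' hx
    · exact fun h => absurd hT h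
  refine ⟨q, fun T hT => ⟨A T, hqT T hT⟩, fun v hv => ?_⟩
  have hzero : ∀ T ∈ M.elems, ∃ B : E d →ᵃ[ℝ] ℝ, ∀ x ∈ interior (simplex T),
      (g x - q x) * v x = (g x - A T x) * B x := by
    intro T hT
    obtain ⟨B, hB⟩ := hv T hT
    exact ⟨B, fun x hx => by rw [hqT T hT x hx, hB x hx]⟩
  rw [setIntegral_congr_set (M.ae_eq_iUnion_interior hL),
    integral_biUnion_finset _ (fun T _ => isOpen_interior.measurableSet)
      (fun T hT T' hT' hne => M.disjoint_interior hT hT' hne)]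
  · refine Finset.sum_eq_zero fun T hT => ?_
    obtain ⟨B, hB⟩ := hzero T hT
    rw [setIntegral_congr_fun isOpen_interior.measurableSet hB]
    exact hA T hT B
  · intro T hT
    obtain ⟨B, hB⟩ := hzero T hT
    rw [integrableOn_congr_fun hB isOpen_interior.measurableSet]
    exact ((hg' T hT).sub (memLp_affine (A T) (isBounded_interior_simplex T))).integrable_mul
      (memLp_affine (p := 2) B (isBounded_interior_simplex T))

/-- The only property of the projection that the estimates need. -/
lemma Mesh.piecewiseAffine_l2Proj (M : Mesh Ω) (hL : HasLipschitzBoundary Ω) {g : E d → ℝ}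
    (hg : MemLp g 2 (volume.restrict Ω)) : M.PiecewiseAffine (M.l2Proj g) :=
  (Classical.epsilon_spec (M.exists_isL2Proj hL hg)).1

/-! ### The weak equation tested with a bump -/

/-- `-ΔW = g` in the sense of distributions. -/
def WeakSol (Ω : Set (E d)) (W g : E d → ℝ) : Prop :=
  ∀ (b : OrthonormalBasis (Fin d) ℝ (E d)) (φ : E d → ℝ), IsTest Ω φ →
    -∫ x in Ω, W x * lap b φ x = ∫ x in Ω, g x * φ x

lemma abs_setIntegral_mul_le {s : Set (E d)} (hs : volume s < ⊤) {g φ : E d → ℝ} {m c : ℝ}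
    (hg : ∀ᵐ x ∂volume.restrict s, |g x| ≤ m) (hφ : ∀ x, |φ x| ≤ c) :
    |∫ x in s, g x * φ x| ≤ m * c * volume.real s := by
  rw [← Real.norm_eq_abs]
  refine norm_setIntegral_le_of_norm_le_const_ae hs ?_
  filter_upwards [hg] with x hx
  rw [norm_mul]
  exact mul_le_mul hx (hφ x) (abs_nonneg _) ((abs_nonneg _).trans hx)

lemma abs_setIntegral_mul_le_l2 {s : Set (E d)} (hs : volume s < ⊤) {g φ : E d → ℝ}
    (hg : MemLp g 2 (volume.restrict s)) (hφ : ∀ x, |φ x| ≤ 1) :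
    |∫ x in s, g x * φ x| ≤ (l2Norm g s).toReal * √(volume.real s) := by
  have : IsFiniteMeasure (volume.restrict s) := ⟨by simpa using hs⟩
  have hi : Integrable g (volume.restrict s) := hg.integrable (by norm_num)
  have h1 : |∫ x in s, g x * φ x| ≤ ∫ x in s, ‖g x‖ := by
    rw [← Real.norm_eq_abs]
    refine (norm_integral_le_integral_norm _).trans ?_
    refine integral_mono_of_nonneg (Eventually.of_forall fun x => norm_nonneg _) hi.norm
      (Eventually.of_forall fun x => ?_)
    simp only [norm_mul]
    exact mul_le_of_le_one_right (norm_nonneg _) (hφ x)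
  refine h1.trans ?_
  rw [integral_norm_eq_lintegral_enorm hi.aestronglyMeasurable, ← eLpNorm_one_eq_lintegral_enorm]
  have h2 := eLpNorm_le_eLpNorm_mul_rpow_measure_univ (p := 1) (q := 2) (by norm_num)
    hi.aestronglyMeasurable
  have h3 : (eLpNorm g 2 (volume.restrict s) *
      volume.restrict s univ ^ (1 / (1 : ℝ≥0∞).toReal - 1 / (2 : ℝ≥0∞).toReal)).toReal
      = (l2Norm g s).toReal * √(volume.real s) := by
    rw [ENNReal.toReal_mul, ← ENNReal.toReal_rpow, Measure.restrict_apply_univ, Real.sqrt_eq_rpow]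
    norm_num [l2Norm, Measure.real]
  rw [← h3]
  refine ENNReal.toReal_mono (ENNReal.mul_ne_top hg.eLpNorm_ne_top ?_) h2
  exact ENNReal.rpow_ne_top_of_nonneg (by norm_num) (by simpa using hs.ne)

/-- The volume of the unit ball. -/
def unitVol (d : ℕ) : ℝ := volume.real (Metric.closedBall (0 : E d) 1)

lemma unitVol_nonneg : 0 ≤ unitVol d := measureReal_nonneg

lemma volume_real_closedBall (z : E d) {R : ℝ} (hR : 0 ≤ R) :
    volume.real (Metric.closedBall z R) = R ^ d * unitVol d := by
  rw [Measure.addHaar_real_closedBall' _ _ hR]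
  simp [unitVol]

/-- The weight of the `L^2` norms in the indicators. -/
def weight (d : ℕ) (h : ℝ) : ℝ := h ^ (2 - (d : ℝ) / 2)

lemma weight_nonneg {h : ℝ} (hh : 0 ≤ h) : 0 ≤ weight d h := Real.rpow_nonneg hh _

/-- Explains the exponent `2 - d / 2`: on a set of volume of order `h ^ d`, the weighted `L²` norm
scales like `h ^ 2` times a sup norm. -/
lemma weight_mul_sqrt {h : ℝ} (hh : 0 < h) : weight d h * √(h ^ d) = h ^ 2 := by
  rw [weight, Real.sqrt_eq_rpow, ← Real.rpow_natCast h d, ← Real.rpow_mul hh.le,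
    ← Real.rpow_add hh, ← Real.rpow_natCast]
  congr 1
  push_cast; ring

/-- The residual of an approximation `w` with data `Q + sT`, tested with a bump. -/
lemma weak_error {L : ℝ} (hL0 : 0 ≤ L) (hL : ∀ t, |cutoff'' t| ≤ L) {W D s w Q sT : E d → ℝ}
    (hsol : WeakSol Ω W fun x => D x + s x) {z : E d} {ρ H X : ℝ} (hρ : 0 < ρ) (hH : ρ ≤ H)
    (hB : Metric.closedBall z (d * ρ) ⊆ Ω) (hW : MemLp W 2 (volume.restrict Ω))
    (hD : MemLp D 2 (volume.restrict Ω)) (hs : MemLp s 2 (volume.restrict Ω))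
    (hw : MemLp w 2 (volume.restrict (Metric.closedBall z (d * ρ))))
    (hQ : MemLp Q 2 (volume.restrict (Metric.closedBall z (d * ρ))))
    (hsT : MemLp sT 2 (volume.restrict (Metric.closedBall z (d * ρ))))
    (hWw : ∀ᵐ x ∂volume.restrict (Metric.closedBall z (d * ρ)), |W x - w x| ≤ X)
    (hss : ∀ᵐ x ∂volume.restrict (Metric.closedBall z (d * ρ)), |s x - sT x| ≤ X)
    (hX : 0 ≤ X)
    (hN : weight d ρ * (l2Norm (fun x => D x - Q x) (Metric.closedBall z (d * ρ))).toReal ≤ X)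
    (b : OrthonormalBasis (Fin d) ℝ (E d)) :
    |(∫ x in Metric.closedBall z (d * ρ), w x * lap b (bump b z ρ) x) +
      ∫ x in Metric.closedBall z (d * ρ), (Q x + sT x) * bump b z ρ x| ≤
      ρ ^ d * (ρ⁻¹) ^ 2 * ((d * L * (d ^ d * unitVol d) + H ^ 2 * (d ^ d * unitVol d) +
        √(d ^ d * unitVol d)) * X) := by
  set B := Metric.closedBall z (d * ρ) with hBdef
  set φ := bump b z ρ with hφdef
  have hd0 : (0 : ℝ) ≤ d * ρ := by positivity
  have ht : IsTest Ω φ := isTest_bump b hρ hB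
  have hBc : IsCompact B := isCompact_closedBall z _
  have hvolB : volume B < ⊤ := hBc.measure_lt_top
  have hres : ∀ {g : E d → ℝ}, MemLp g 2 (volume.restrict Ω) → MemLp g 2 (volume.restrict B) :=
    fun hg => hg.mono_measure (Measure.restrict_mono hB le_rfl)
  have hφ2 : MemLp φ 2 (volume.restrict B) :=
    Continuous.memLp_of_hasCompactSupport ht.contDiff.continuous ht.compact
  have hlap2 : MemLp (lap b φ) 2 (volume.restrict B) :=
    Continuous.memLp_of_hasCompactSupport (continuous_lap b ht.contDiff)
      (hasCompactSupport_lap b ht.compact)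
  -- The bump is supported in the ball `B`, so the equation on `Ω` can be read on `B`.
  have e0 : -∫ x in B, W x * lap b φ x = ∫ x in B, (D x + s x) * φ x := by
    have htB : IsTest B φ := isTest_bump b hρ subset_rfl
    have z1 : ∀ x, x ∉ tsupport φ → W x * lap b φ x = 0 := fun x hx => by
      rw [lap_eq_zero b hx, mul_zero]
    have z2 : ∀ x, x ∉ tsupport φ → (D x + s x) * φ x = 0 := fun x hx => by
      rw [image_eq_zero_of_notMem_tsupport hx, mul_zero]
    rw [htB.setIntegral_eq z1, htB.setIntegral_eq z2, ← ht.setIntegral_eq z1,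
      ← ht.setIntegral_eq z2]
    exact hsol b φ ht
  have i1 : IntegrableOn (fun x => (W x - w x) * lap b φ x) B :=
    ((hres hW).sub hw).integrable_mul (q := 2) hlap2
  have i2 : IntegrableOn (fun x => W x * lap b φ x) B := (hres hW).integrable_mul (q := 2) hlap2
  have i3 : IntegrableOn (fun x => (D x - Q x) * φ x) B :=
    ((hres hD).sub hQ).integrable_mul (q := 2) hφ2
  have i4 : IntegrableOn (fun x => (s x - sT x) * φ x) B :=
    ((hres hs).sub hsT).integrable_mul (q := 2) hφ2
  have i5 : IntegrableOn (fun x => (D x + s x) * φ x) B :=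
    ((hres hD).add (hres hs)).integrable_mul (q := 2) hφ2
  have e1 : ∫ x in B, w x * lap b φ x
      = (∫ x in B, W x * lap b φ x) - ∫ x in B, (W x - w x) * lap b φ x := by
    rw [← integral_sub i2 i1]
    exact integral_congr_ae (Eventually.of_forall fun x => by simp only; ring)
  have e2 : ∫ x in B, (Q x + sT x) * φ x = (∫ x in B, (D x + s x) * φ x)
      - (∫ x in B, (D x - Q x) * φ x) - ∫ x in B, (s x - sT x) * φ x := by
    have i6 : IntegrableOn (fun x => (D x + s x) * φ x - (D x - Q x) * φ x) B := i5.sub i3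
    rw [← integral_sub i5 i3, ← integral_sub i6 i4]
    exact integral_congr_ae (Eventually.of_forall fun x => by simp only; ring)
  have b1 := abs_setIntegral_mul_le hvolB hWw (abs_lap_bump_le hL0 hL b z ρ)
  have b2 := abs_setIntegral_mul_le hvolB hss (abs_bump_le_one b z ρ)
  have b3 := abs_setIntegral_mul_le_l2 hvolB ((hres hD).sub hQ) (abs_bump_le_one b z ρ)
  have hvol : volume.real B = ρ ^ d * (d ^ d * unitVol d) := by
    rw [hBdef, volume_real_closedBall z hd0, mul_pow]; ring
  have hV0 : 0 ≤ (d : ℝ) ^ d * unitVol d := mul_nonneg (by positivity) unitVol_nonneg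
  -- `ρ ^ d * ρ⁻¹ ^ 2` is the natural size of the integral of `|Δφ|`; the other terms are brought to
  -- the same factor, the `L²` one through its weight.
  have hsq : √(volume.real B) = ρ ^ d * (ρ⁻¹) ^ 2 * weight d ρ * √(d ^ d * unitVol d) := by
    rw [hvol, Real.sqrt_mul (by positivity)]
    congr 1
    have h1 := weight_mul_sqrt (d := d) hρ
    have h2 : √(ρ ^ d) * √(ρ ^ d) = ρ ^ d := Real.mul_self_sqrt (by positivity)
    have h3 : ρ ^ d * (ρ⁻¹) ^ 2 * weight d ρ = √(ρ ^ d) * (ρ⁻¹ ^ 2 * (weight d ρ * √(ρ ^ d))) := by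
      nth_rewrite 1 [← h2]; ring
    rw [h3, h1]
    field_simp
  set V := (d : ℝ) ^ d * unitVol d
  have c1 : |∫ x in B, (W x - w x) * lap b φ x| ≤ ρ ^ d * (ρ⁻¹) ^ 2 * (d * L * V * X) := by
    refine b1.trans (le_of_eq ?_)
    rw [hvol]; ring
  have c2 : |∫ x in B, (s x - sT x) * φ x| ≤ ρ ^ d * (ρ⁻¹) ^ 2 * (H ^ 2 * V * X) := by
    refine b2.trans ?_
    rw [hvol]
    -- The term in `s - sT` lacks the factor `ρ⁻²`; the bound `ρ ≤ H` supplies it at the price of `H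
    -- ^ 2`.
    have h1 : 1 ≤ (ρ⁻¹) ^ 2 * H ^ 2 := by
      rw [← mul_pow]
      refine one_le_pow₀ ?_
      rw [inv_mul_eq_div, le_div_iff₀ hρ]; linarith
    calc X * 1 * (ρ ^ d * V) = ρ ^ d * (V * X) * 1 := by ring
      _ ≤ ρ ^ d * (V * X) * ((ρ⁻¹) ^ 2 * H ^ 2) := by gcongr
      _ = _ := by ring
  have c3 : |∫ x in B, (D x - Q x) * φ x| ≤ ρ ^ d * (ρ⁻¹) ^ 2 * (√V * X) := by
    refine b3.trans ?_
    rw [hsq]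
    set N := (l2Norm (fun x => D x - Q x) B).toReal
    calc N * (ρ ^ d * (ρ⁻¹) ^ 2 * weight d ρ * √V)
        = ρ ^ d * (ρ⁻¹) ^ 2 * √V * (weight d ρ * N) := by ring
      _ ≤ ρ ^ d * (ρ⁻¹) ^ 2 * √V * X := by gcongr
      _ = _ := by ring
  -- Subtracting the equation for `W` leaves only the three errors, none of them differentiated.
  have key : (∫ x in B, w x * lap b φ x) + ∫ x in B, (Q x + sT x) * φ x
      = -(∫ x in B, (W x - w x) * lap b φ x) - (∫ x in B, (D x - Q x) * φ x)
        - ∫ x in B, (s x - sT x) * φ x := by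
    rw [e1, e2, ← e0]; ring
  rw [key]
  have tri : ∀ p q r : ℝ, |-p - q - r| ≤ |p| + |q| + |r| := fun p q r => by
    refine (abs_sub _ _).trans (add_le_add_left ((abs_sub _ _).trans ?_) _)
    rw [abs_neg]
  refine (tri _ _ _).trans ((add_le_add (add_le_add c1 c3) c2).trans (le_of_eq ?_))
  ring

/-- The exponent `2 - d / 2` is positive here, so passing from a bump's scale to the element size
only enlarges the weight. -/
lemma weight_mono (hd : d ≤ 3) {h k : ℝ} (hh : 0 ≤ h) (hk : h ≤ k) : weight d h ≤ weight d k := by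
  have : (d : ℝ) ≤ 3 := by exact_mod_cast hd
  exact Real.rpow_le_rpow hh hk (by linarith)

/-! ### The interior residual -/

/-- A square integrable distributional solution of `-ΔW = D + s` with square integrable data. -/
structure Problem (Ω : Set (E d)) (W D s : E d → ℝ) : Prop where
  sol : WeakSol Ω W fun x => D x + s x
  memW : MemLp W 2 (volume.restrict Ω)
  memD : MemLp D 2 (volume.restrict Ω)
  memS : MemLp s 2 (volume.restrict Ω)

/-- The approximations on one element, with all errors measured by `X`. -/
structure ElemError (σ H : ℝ) (W D s WT Q sT : E d → ℝ) (X : ℝ) (T : Finset (E d)) (c : E d)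
    (r : ℝ) (A AQ As : E d →ᵃ[ℝ] ℝ) : Prop where
  r_pos : 0 < r
  ball : Metric.closedBall c r ⊆ simplex T
  size_le : size T ≤ σ * r
  size_le' : size T ≤ H
  eqW : ∀ x ∈ simplex T, WT x = A x
  eqQ : ∀ x ∈ interior (simplex T), Q x = AQ x
  eqS : ∀ x ∈ simplex T, sT x = As x
  nonneg : 0 ≤ X
  errW : ∀ᵐ x ∂volume.restrict (simplex T), |W x - WT x| ≤ X
  errS : ∀ᵐ x ∂volume.restrict (simplex T), |s x - sT x| ≤ X
  finite : l2Norm (fun x => D x - Q x) (simplex T) ≠ ⊤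
  errD : weight d (size T) * (l2Norm (fun x => D x - Q x) (simplex T)).toReal ≤ X

lemma le_size (hd : 0 < d) {T : Finset (E d)} {c : E d} {r : ℝ} (hr : 0 < r)
    (hb : Metric.closedBall c r ⊆ simplex T) : r ≤ size T := by
  let e : E d := EuclideanSpace.single ⟨0, hd⟩ 1
  have he : ‖e‖ = 1 := by simp [e]
  have h1 : c + r • e ∈ simplex T := hb (by simp [norm_smul, he, abs_of_pos hr])
  have h2 : c ∈ simplex T := hb (Metric.mem_closedBall_self hr.le)
  have h := dist_le_size h1 h2
  rwa [dist_eq_norm, add_sub_cancel_left, norm_smul, he, mul_one, Real.norm_of_nonneg hr.le] at h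

/-- A bump centred at `z` in the inscribed ball reads off the affine residual exactly at `z`. The
values at the centre `c` and at a point at distance `r / 2` bound the gradient, hence the residual
on all of `T`. The constant precedes `Ω` and all functions in the quantifiers, so the bound is
uniform in them. -/
lemma exists_element_bound (hd : 0 < d) (hd3 : d ≤ 3) {σ H : ℝ} (hσ : 1 ≤ σ) :
    ∃ C, 0 ≤ C ∧ ∀ (Ω : Set (E d)) (W D s WT Q sT : E d → ℝ), Problem Ω W D s →
      ∀ (X : ℝ) (T : Finset (E d)) (c : E d) (r : ℝ) (A AQ As : E d →ᵃ[ℝ] ℝ),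
      interior (simplex T) ⊆ Ω → ElemError σ H W D s WT Q sT X T c r A AQ As →
      ∀ x ∈ simplex T, size T ^ 2 * |AQ x + As x| ≤ C * X := by
  obtain ⟨L, hL0, hL⟩ := exists_cutoff''_bound
  have hd' : (1 : ℝ) ≤ d := by exact_mod_cast hd
  set K := d * L * (d ^ d * unitVol d) + H ^ 2 * (d ^ d * unitVol d) + √(d ^ d * unitVol d) with hK
  have hV0 : 0 ≤ (d : ℝ) ^ d * unitVol d := mul_nonneg (by positivity) unitVol_nonneg
  have hK0 : 0 ≤ K := by positivity
  have hm := mass_pos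
  -- `1` comes from the value at `c`, `4 * σ` from the gradient, `(4 * d * σ) ^ 2` from `(h / ρ) ^
  -- 2`.
  refine ⟨(1 + 4 * σ) * ((4 * d * σ) ^ 2 * (K / mass ^ d)), by positivity, ?_⟩
  intro Ω W D s WT Q sT hP X T c r A AQ As hint hE x hx
  have hr := hE.r_pos
  have hh : 0 < size T := hr.trans_le (le_size hd hr hE.ball)
  set h := size T with hdef
  -- Then `d * ρ ≤ r / 4`, so the bump at any point within `r / 2` of `c` is supported inside the
  -- inscribed ball.
  set ρ := h / (4 * d * σ) with hρdef
  have hρ : 0 < ρ := by positivity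
  have hρh : ρ ≤ h := div_le_self hh.le (by nlinarith)
  have hdρ : d * ρ ≤ r / 4 := by
    have : d * ρ = h / σ / 4 := by rw [hρdef]; field_simp
    rw [this]
    have : h / σ ≤ r := by rw [div_le_iff₀ (by linarith)]; linarith [hE.size_le]
    linarith
  set b : OrthonormalBasis (Fin d) ℝ (E d) := EuclideanSpace.basisFun (Fin d) ℝ
  have hbi : Metric.ball c r ⊆ interior (simplex T) :=
    interior_maximal (Metric.ball_subset_closedBall.trans hE.ball) Metric.isOpen_ball
  have point : ∀ z, dist z c ≤ r / 2 → h ^ 2 * |AQ z + As z| ≤ (4 * d * σ) ^ 2 * (K / mass ^ d) * X := by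
    intro z hz
    have hBi : Metric.closedBall z (d * ρ) ⊆ interior (simplex T) :=
      (Metric.closedBall_subset_ball' (by linarith)).trans hbi
    have hBT : Metric.closedBall z (d * ρ) ⊆ simplex T := hBi.trans interior_subset
    have hBb : Bornology.IsBounded (Metric.closedBall z (d * ρ)) := Metric.isBounded_closedBall
    have hmem : ∀ᵐ x ∂volume.restrict (Metric.closedBall z (d * ρ)),
        x ∈ Metric.closedBall z (d * ρ) := ae_restrict_mem Metric.isClosed_closedBall.measurableSet
    have hcongr : l2Norm (fun x => D x - AQ x) (Metric.closedBall z (d * ρ))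
        = l2Norm (fun x => D x - Q x) (Metric.closedBall z (d * ρ)) := by
      refine eLpNorm_congr_ae ?_
      filter_upwards [hmem] with x hx
      rw [hE.eqQ x (hBi hx)]
    have key := weak_error hL0 hL (w := A) (Q := AQ) (sT := As) hP.sol hρ (hρh.trans hE.size_le')
      (hBi.trans hint) hP.memW hP.memD hP.memS (memLp_affine A hBb) (memLp_affine AQ hBb)
      (memLp_affine As hBb) (X := X) ?_ ?_ hE.nonneg ?_ b
    · have ht : IsTest (Metric.closedBall z (d * ρ)) (bump b z ρ) := isTest_bump b hρ subset_rfl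
      rw [ht.setIntegral_eq fun x hx => by rw [lap_eq_zero b hx, mul_zero],
        ht.setIntegral_eq fun x hx => by rw [image_eq_zero_of_notMem_tsupport hx, mul_zero],
        integral_affine_mul_lap b A ht.contDiff ht.compact, zero_add] at key
      have e := integral_affine_mul_bump b z hρ (AQ + As)
      simp only [AffineMap.coe_add, Pi.add_apply] at e
      rw [e, abs_mul, abs_of_pos (show 0 < ρ ^ d * mass ^ d by positivity), ← hK] at key
      have h2 : ρ ^ 2 * |AQ z + As z| ≤ K / mass ^ d * X := by
        have h3 : |AQ z + As z| * (ρ ^ d * mass ^ d) =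
            ρ ^ d * (ρ⁻¹) ^ 2 * (mass ^ d * (ρ ^ 2 * |AQ z + As z|)) := by field_simp
        rw [h3] at key
        have h4 := le_of_mul_le_mul_left key (by positivity)
        rw [div_mul_eq_mul_div, le_div_iff₀ (by positivity)]
        linarith
      have h5 : h = 4 * d * σ * ρ := by rw [hρdef]; field_simp
      calc h ^ 2 * |AQ z + As z| = (4 * d * σ) ^ 2 * (ρ ^ 2 * |AQ z + As z|) := by rw [h5]; ring
        _ ≤ (4 * d * σ) ^ 2 * (K / mass ^ d * X) := by gcongr
        _ = _ := by ring
    · filter_upwards [hmem, ae_mono (Measure.restrict_mono hBT le_rfl) hE.errW] with x hx h1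
      rwa [← hE.eqW x (hBT hx)]
    · filter_upwards [hmem, ae_mono (Measure.restrict_mono hBT le_rfl) hE.errS] with x hx h1
      rwa [← hE.eqS x (hBT hx)]
    · rw [hcongr]
      refine le_trans (mul_le_mul (weight_mono hd3 hρ.le hρh) ?_ ENNReal.toReal_nonneg
        (weight_nonneg hh.le)) hE.errD
      exact ENNReal.toReal_mono hE.finite (eLpNorm_mono_measure _ (Measure.restrict_mono hBT le_rfl))
  set q : E d →ᵃ[ℝ] ℝ := AQ + As with hq
  have hqx : ∀ y, AQ y + As y = q y := fun y => rfl
  simp only [hqx] at point ⊢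
  have hc := point c (by rw [dist_self]; positivity)
  set g := agrad q
  have hxc : |q x| ≤ |q c| + ‖g‖ * h := by
    have h1 := affine_sub q x c
    have h2 := abs_real_inner_le_norm g (x - c)
    have h3 : ‖x - c‖ ≤ h := by
      rw [← dist_eq_norm]
      exact dist_le_size hx (hE.ball (Metric.mem_closedBall_self hr.le))
    have h4 : |q x - q c| ≤ ‖g‖ * h := by
      rw [h1]; exact h2.trans (mul_le_mul_of_nonneg_left h3 (norm_nonneg _))
    have h5 := abs_sub_abs_le_abs_sub (q x) (q c)
    linarith
  set Y := (4 * d * σ) ^ 2 * (K / mass ^ d) * X with hY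
  have hg : h ^ 2 * (‖g‖ * h) ≤ 4 * σ * Y := by
    rcases eq_or_ne g 0 with h0 | h0
    · rw [h0, norm_zero, zero_mul, mul_zero]
      have := hE.nonneg
      positivity
    have hn : 0 < ‖g‖ := norm_pos_iff.2 h0
    have hv : ‖(r / 2 / ‖g‖) • g‖ = r / 2 := by
      rw [norm_smul, Real.norm_of_nonneg (by positivity)]; field_simp
    -- Going from `c` in the direction of `g` makes the increment of `q` equal to `r / 2 * ‖g‖`.
    have hc' := point (c + (r / 2 / ‖g‖) • g) (by
      rw [dist_eq_norm, add_sub_cancel_left, hv])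
    have h1 := affine_sub q (c + (r / 2 / ‖g‖) • g) c
    rw [add_sub_cancel_left, inner_smul_right, real_inner_self_eq_norm_sq,
      show r / 2 / ‖g‖ * ‖g‖ ^ 2 = r / 2 * ‖g‖ by field_simp] at h1
    set qc' := q (c + (r / 2 / ‖g‖) • g)
    have h2 : r / 2 * ‖g‖ ≤ |qc'| + |q c| := by
      rw [← h1]; exact (le_abs_self _).trans (abs_sub _ _)
    have h3 : h ^ 2 * (r * ‖g‖) ≤ 4 * Y := by
      have := mul_le_mul_of_nonneg_left h2 (sq_nonneg h)
      rw [mul_add] at this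
      linarith
    calc h ^ 2 * (‖g‖ * h) ≤ h ^ 2 * (‖g‖ * (σ * r)) := by
          have := hE.size_le
          gcongr
      _ = σ * (h ^ 2 * (r * ‖g‖)) := by ring
      _ ≤ σ * (4 * Y) := by gcongr
      _ = _ := by ring
  have := mul_le_mul_of_nonneg_left hxc (sq_nonneg h)
  rw [mul_add] at this
  calc h ^ 2 * |q x| ≤ Y + 4 * σ * Y := by linarith
    _ = _ := by rw [hY]; ring

/-! ### The jump residual -/

lemma l2Norm_union_le {g : E d → ℝ} {s t : Set (E d)} (hs : MeasurableSet s)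
    (ht : MeasurableSet t) (hgs : AEStronglyMeasurable g (volume.restrict s))
    (hgt : AEStronglyMeasurable g (volume.restrict t)) :
    l2Norm g (s ∪ t) ≤ l2Norm g s + l2Norm g t := by
  have hts : MeasurableSet (t \ s) := ht.diff hs
  have hgt' : AEStronglyMeasurable g (volume.restrict (t \ s)) := hgt.mono_set sdiff_subset
  have e : (s ∪ t).indicator g = s.indicator g + (t \ s).indicator g := by
    rw [← union_sdiff_self, indicator_union_of_disjoint disjoint_sdiff_self_right]
    rfl
  simp only [l2Norm]
  rw [← eLpNorm_indicator_eq_eLpNorm_restrict (hs.union ht), e]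
  refine (eLpNorm_add_le ((aestronglyMeasurable_indicator_iff hs).2 hgs)
    ((aestronglyMeasurable_indicator_iff hts).2 hgt') (by norm_num)).trans ?_
  rw [eLpNorm_indicator_eq_eLpNorm_restrict hs, eLpNorm_indicator_eq_eLpNorm_restrict hts]
  gcongr
  exact sdiff_subset

lemma memLp_union {g : E d → ℝ} {s t : Set (E d)} (hs : MeasurableSet s)
    (ht : MeasurableSet t) (hgs : MemLp g 2 (volume.restrict s))
    (hgt : MemLp g 2 (volume.restrict t)) : MemLp g 2 (volume.restrict (s ∪ t)) :=
  ⟨aestronglyMeasurable_union_iff.2 ⟨hgs.1, hgt.1⟩,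
    (l2Norm_union_le hs ht hgs.1 hgt.1).trans_lt (ENNReal.add_lt_top.2 ⟨hgs.2, hgt.2⟩)⟩

/-- A convex set with interior points determines derivatives within it even at its boundary, in
particular on the sides where the jump is evaluated. -/
lemma gradientWithin_eq_agrad {w : E d → ℝ} {T : Finset (E d)} {A : E d →ᵃ[ℝ] ℝ}
    (hw : ∀ x ∈ simplex T, w x = A x) (hne : (interior (simplex T)).Nonempty) {x : E d}
    (hx : x ∈ simplex T) : gradientWithin w (simplex T) x = agrad A := by
  have hu : UniqueDiffWithinAt ℝ (simplex T) x := uniqueDiffOn_convex (convex_simplex T) hne x hx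
  have h1 : HasFDerivAt A (LinearMap.toContinuousLinearMap A.linear) x := by
    rw [A.decomp]
    exact (LinearMap.toContinuousLinearMap A.linear).hasFDerivAt.add_const _
  have h2 := (h1.hasFDerivWithinAt (s := simplex T)).congr hw (hw x hx)
  rw [gradientWithin, h2.fderivWithin hu, agrad]

/-- Used to align one axis of the product bump with the normal of a side. -/
lemma exists_basis_extending (k : Fin d) {ν : E d} (hν : ‖ν‖ = 1) :
    ∃ b : OrthonormalBasis (Fin d) ℝ (E d), b k = ν := by
  have ho : Orthonormal ℝ (({k} : Set (Fin d)).domRestrict fun _ => ν) := by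
    refine ⟨fun _ => hν, fun i j hij => absurd (Subsingleton.elim i j) hij⟩
  obtain ⟨b, hb⟩ := ho.exists_orthonormalBasis_extension_of_card_eq (by simp)
  exact ⟨b, hb k rfl⟩

lemma measurableSet_simplex (T : Finset (E d)) : MeasurableSet (simplex T) :=
  (isCompact_simplex T).isClosed.measurableSet

lemma ae_mem_interior_simplex (T : Finset (E d)) :
    ∀ᵐ x ∂volume.restrict (simplex T), x ∈ interior (simplex T) := by
  rw [← Measure.restrict_congr_set (interior_ae_eq_simplex T)]
  exact ae_restrict_mem isOpen_interior.measurableSet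

lemma interior_simplex_nonempty {T : Finset (E d)} {c : E d} {r : ℝ} (hr : 0 < r)
    (hb : Metric.closedBall c r ⊆ simplex T) : (interior (simplex T)).Nonempty :=
  ⟨c, interior_mono hb (by
    rw [mem_interior_iff_mem_nhds]; exact Metric.closedBall_mem_nhds c hr)⟩

lemma ae_restrict_of_subset_union {P : E d → Prop} {s t B : Set (E d)} (hB : B ⊆ s ∪ t)
    (hs : ∀ᵐ x ∂volume.restrict s, P x) (ht : ∀ᵐ x ∂volume.restrict t, P x) :
    ∀ᵐ x ∂volume.restrict B, P x :=
  ae_mono (Measure.restrict_mono hB le_rfl) (ae_restrict_union_iff _ _ _ |>.2 ⟨hs, ht⟩)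

/-- The affine pieces agree on `S`, so their gradients differ by `J • ν` and near the barycentre `z`
the function is `A' + J (ν·(x - z))₊`. The aligned bump isolates `J`; the possibly discontinuous
residual `Q + sT` is bounded by `exists_element_bound` on each element. -/
lemma exists_jump_bound (hd : 2 ≤ d) (hd3 : d ≤ 3) {σ H : ℝ} (hσ : 1 ≤ σ) :
    ∃ C, 0 ≤ C ∧ ∀ (Ω : Set (E d)), HasLipschitzBoundary Ω →
      ∀ (W D s WT Q sT : E d → ℝ), Problem Ω W D s →
      ∀ (M : Mesh Ω) (X : ℝ) (T T' S : Finset (E d)), T ∈ M.elems → T' ∈ M.elems → T' ≠ T →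
      S.card = d → S ⊆ T → S ⊆ T' →
      ∀ (c : E d) (r : ℝ) (A AQ As : E d →ᵃ[ℝ] ℝ) (c' : E d) (r' : ℝ) (A' AQ' As' : E d →ᵃ[ℝ] ℝ),
      ElemError σ H W D s WT Q sT X T c r A AQ As →
      ElemError σ H W D s WT Q sT X T' c' r' A' AQ' As' →
      ∀ x ∈ simplex S, size T * |jump WT S T T' x| ≤ C * X := by
  obtain ⟨L, hL0, hL⟩ := exists_cutoff''_bound
  have hd0 : 0 < d := by omega
  obtain ⟨C₁, hC₁, helem⟩ := exists_element_bound (H := H) hd0 hd3 hσ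
  have hd' : (1 : ℝ) ≤ d := by exact_mod_cast hd0
  have hσ0 : 0 < σ := by linarith
  set V := (d : ℝ) ^ d * unitVol d with hVdef
  set K := d * L * V + H ^ 2 * V + √V with hK
  have hV0 : 0 ≤ V := mul_nonneg (by positivity) unitVol_nonneg
  have hK0 : 0 ≤ K := by positivity
  have hm := mass_pos
  have hwσ : 0 ≤ weight d σ := weight_nonneg hσ0.le
  refine ⟨d ^ 2 * σ ^ 2 * ((K * (1 + weight d σ) + C₁ * (1 + σ ^ 2) * V) / mass ^ (d - 1)),
    by positivity, ?_⟩
  intro Ω hLip W D s WT Q sT hP M X T T' S hT hT' hne hS hST hST' c r A AQ As c' r' A' AQ' As'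
    hE hE' x₀ hx₀
  have hr := hE.r_pos
  have hr' := hE'.r_pos
  have hX := hE.nonneg
  have hh : 0 < size T := hr.trans_le (le_size hd0 hr hE.ball)
  have hh' : 0 < size T' := hr'.trans_le (le_size hd0 hr' hE'.ball)
  -- Since `d ≥ 2`, the side contains an edge common to both elements; its length is at least `2 *
  -- r` and at most `size T'`.
  obtain ⟨p, hp, p', hp', hpp⟩ := Finset.one_lt_card.1 (show 1 < S.card by omega)
  have hsize : 2 * r ≤ size T' :=
    (two_mul_le_dist (M.card_eq T hT) (M.indep T hT) hr hE.ball (hST hp) (hST hp') hpp).trans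
      (dist_le_size (subset_simplex T' (hST' hp)) (subset_simplex T' (hST' hp')))
  have hsz : size T ≤ σ * size T' := hE.size_le.trans (by gcongr; linarith)
  obtain ⟨ν, hν, hn, hn', hperp, hhalf⟩ := M.side_geometry hd0 hT hT' hne hS hST hST' hr hE.ball
    hr' hE'.ball
  set z := barycentre S with hz
  set J : ℝ := inner ℝ ν (agrad A - agrad A') with hJ
  have hAS : ∀ p ∈ S, A p = A' p := fun p hp => by
    rw [← hE.eqW p (subset_simplex T (hST hp)), ← hE'.eqW p (subset_simplex T' (hST' hp))]
  have hAz : A z = A' z := by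
    rw [hz, affine_barycentre hS hd0, affine_barycentre hS hd0, Finset.sum_congr rfl hAS]
  have hgrad : agrad A - agrad A' = J • ν := hperp _ fun p hp q hq => by
    rw [inner_sub_left, ← affine_sub, ← affine_sub, hAS p hp, hAS q hq, sub_self]
  have hjump : jump WT S T T' x₀ = J := by
    rw [jump, hn, hn', gradientWithin_eq_agrad hE.eqW (interior_simplex_nonempty hr hE.ball)
        (convexHull_mono (by exact_mod_cast hST) hx₀),
      gradientWithin_eq_agrad hE'.eqW (interior_simplex_nonempty hr' hE'.ball)
        (convexHull_mono (by exact_mod_cast hST') hx₀), inner_neg_left, hJ, inner_sub_right]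
    ring
  rw [hjump]
  set h := size T with hdef
  -- One `σ` passes from `h` to `r`, the second to `r'`; one `d` comes from the support radius `d *
  -- ρ`, the other from the admissible distance to the barycentre in `side_geometry`.
  set ρ := h / (d ^ 2 * σ ^ 2) with hρdef
  have hρ : 0 < ρ := by positivity
  have hρh : ρ ≤ h := div_le_self hh.le (one_le_mul_of_one_le_of_one_le (one_le_pow₀ hd')
    (one_le_pow₀ hσ))
  have hρr : d * (d * ρ) ≤ min r r' := by
    have e : d * (d * ρ) = h / σ / σ := by rw [hρdef]; field_simp
    have h1 : h / σ ≤ r := by rw [div_le_iff₀ hσ0]; linarith [hE.size_le]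
    rw [e]
    refine le_min ((div_le_self (by positivity) hσ).trans h1) ?_
    rw [div_le_iff₀ hσ0]
    linarith [hE'.size_le]
  have hmin : 0 < min r r' := lt_min hr hr'
  set B := Metric.closedBall z (d * ρ) with hB
  have hBU : B ⊆ Metric.ball z (2 * min r r' / d) := by
    refine Metric.closedBall_subset_ball ?_
    rw [lt_div_iff₀ (by linarith)]
    linarith
  have hUnear : ∀ x ∈ Metric.ball z (2 * min r r' / d), d * dist x z ≤ 2 * min r r' := by
    intro x hx
    rw [Metric.mem_ball, lt_div_iff₀ (by linarith)] at hx
    linarith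
  have hUT : Metric.ball z (2 * min r r' / d) ⊆ simplex T ∪ simplex T' := by
    intro x hx
    rcases le_total 0 (inner ℝ ν (x - z) : ℝ) with h0 | h0
    · exact Or.inl ((hhalf x (hUnear x hx)).1 h0)
    · exact Or.inr ((hhalf x (hUnear x hx)).2 h0)
  have hBT : B ⊆ simplex T ∪ simplex T' := hBU.trans hUT
  -- `B` sits in an open ball covered by the two elements, hence in the interior of `closure Ω`.
  have hBΩ : B ⊆ Ω := hBU.trans ((interior_maximal
    (hUT.trans (union_subset (M.simplex_subset hT) (M.simplex_subset hT')))
      Metric.isOpen_ball).trans hLip.interior_closure_subset)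
  have hBb : Bornology.IsBounded B := Metric.isBounded_closedBall
  have hwB : ∀ x ∈ B, WT x = A' x + J * max (inner ℝ ν (x - z)) 0 := by
    intro x hx
    have hx' := hUnear x (hBU hx)
    rcases le_total 0 (inner ℝ ν (x - z) : ℝ) with h0 | h0
    · rw [max_eq_left h0, hE.eqW x ((hhalf x hx').1 h0)]
      have e1 := affine_sub A x z
      have e2 := affine_sub A' x z
      have e3 : inner ℝ (agrad A) (x - z) - inner ℝ (agrad A') (x - z)
          = J * inner ℝ ν (x - z) := by
        rw [← inner_sub_left, hgrad, inner_smul_left]; rfl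
      linarith
    · rw [max_eq_right h0, hE'.eqW x ((hhalf x hx').2 h0), mul_zero, add_zero]
  obtain ⟨b, hb⟩ := exists_basis_extending ⟨0, hd0⟩ hν
  set w : E d → ℝ := fun x => A' x + J * max (inner ℝ ν (x - z)) 0 with hw
  have hmaxc : Continuous fun x : E d => max (inner ℝ ν (x - z) : ℝ) 0 :=
    Continuous.max (by fun_prop) continuous_const
  have hwc : Continuous w := (continuous_affine A').add (continuous_const.mul hmaxc)
  have hmem : ∀ᵐ x ∂volume.restrict B, x ∈ B :=
    ae_restrict_mem Metric.isClosed_closedBall.measurableSet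
  have hmeas := measurableSet_simplex T
  have hmeas' := measurableSet_simplex T'
  have hQae : Q =ᵐ[volume.restrict (simplex T)] AQ :=
    (ae_mem_interior_simplex T).mono fun x hx => hE.eqQ x hx
  have hQae' : Q =ᵐ[volume.restrict (simplex T')] AQ' :=
    (ae_mem_interior_simplex T').mono fun x hx => hE'.eqQ x hx
  have hSae : sT =ᵐ[volume.restrict (simplex T)] As :=
    (ae_restrict_mem hmeas).mono fun x hx => hE.eqS x hx
  have hSae' : sT =ᵐ[volume.restrict (simplex T')] As' :=
    (ae_restrict_mem hmeas').mono fun x hx => hE'.eqS x hx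
  have hQT : MemLp Q 2 (volume.restrict (simplex T)) :=
    (memLp_affine AQ (isBounded_simplex T)).ae_eq hQae.symm
  have hQT' : MemLp Q 2 (volume.restrict (simplex T')) :=
    (memLp_affine AQ' (isBounded_simplex T')).ae_eq hQae'.symm
  have hQB : MemLp Q 2 (volume.restrict B) :=
    (memLp_union hmeas hmeas' hQT hQT').mono_measure (Measure.restrict_mono hBT le_rfl)
  have hSB : MemLp sT 2 (volume.restrict B) :=
    (memLp_union hmeas hmeas' ((memLp_affine As (isBounded_simplex T)).ae_eq hSae.symm)
      ((memLp_affine As' (isBounded_simplex T')).ae_eq hSae'.symm)).mono_measure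
        (Measure.restrict_mono hBT le_rfl)
  have hDT : ∀ {T₁ : Finset (E d)}, T₁ ∈ M.elems → MemLp D 2 (volume.restrict (simplex T₁)) := by
    intro T₁ hT₁
    rw [← Measure.restrict_congr_set (interior_ae_eq_simplex T₁)]
    exact hP.memD.mono_measure (Measure.restrict_mono (M.interior_simplex_subset hLip hT₁) le_rfl)
  -- The extra `weight d σ` pays for replacing the weight of `T` by that of `T'` in the oscillation
  -- on `T'`.
  set X' := (1 + weight d σ) * X with hX'
  have hXX' : X ≤ X' := by nlinarith
  have hN : weight d ρ * (l2Norm (fun x => D x - Q x) B).toReal ≤ X' := by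
    set N := (l2Norm (fun x => D x - Q x) (simplex T)).toReal
    set N' := (l2Norm (fun x => D x - Q x) (simplex T')).toReal
    have h1 : (l2Norm (fun x => D x - Q x) B).toReal ≤ N + N' := by
      rw [← ENNReal.toReal_add hE.finite hE'.finite]
      refine ENNReal.toReal_mono (ENNReal.add_ne_top.2 ⟨hE.finite, hE'.finite⟩) ?_
      exact (eLpNorm_mono_measure _ (Measure.restrict_mono hBT le_rfl)).trans
        (l2Norm_union_le hmeas hmeas' ((hDT hT).sub hQT).1 ((hDT hT').sub hQT').1)
    have h2 : weight d ρ ≤ weight d h := weight_mono hd3 hρ.le hρh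
    have h3 : weight d h ≤ weight d σ * weight d (size T') := by
      rw [weight, weight, weight, ← Real.mul_rpow hσ0.le hh'.le]
      exact weight_mono hd3 hh.le hsz
    calc weight d ρ * (l2Norm (fun x => D x - Q x) B).toReal
        ≤ weight d h * (N + N') := mul_le_mul h2 h1 ENNReal.toReal_nonneg (weight_nonneg hh.le)
      _ = weight d h * N + weight d h * N' := mul_add _ _ _
      _ ≤ X + weight d σ * weight d (size T') * N' := by
          refine add_le_add hE.errD (mul_le_mul_of_nonneg_right h3 ENNReal.toReal_nonneg)
      _ = X + weight d σ * (weight d (size T') * N') := by ring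
      _ ≤ X + weight d σ * X := by gcongr; exact hE'.errD
      _ = X' := by rw [hX']; ring
  have errW : ∀ᵐ x ∂volume.restrict B, |W x - w x| ≤ X' := by
    filter_upwards [hmem, ae_restrict_of_subset_union hBT hE.errW hE'.errW] with x hx h1
    have e : w x = WT x := (hwB x hx).symm
    rw [e]
    exact h1.trans hXX'
  have errS : ∀ᵐ x ∂volume.restrict B, |s x - sT x| ≤ X' :=
    (ae_restrict_of_subset_union hBT hE.errS hE'.errS).mono fun x hx => hx.trans hXX'
  have key := weak_error hL0 hL (w := w) (Q := Q) (sT := sT) hP.sol hρ (hρh.trans hE.size_le') hBΩ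
    hP.memW hP.memD hP.memS (memLp_of_continuous_bounded hwc hBb) hQB hSB errW errS
    (hX.trans hXX') hN b
  have ht : IsTest B (bump b z ρ) := isTest_bump b hρ subset_rfl
  have hint : ∫ x in B, w x * lap b (bump b z ρ) x = J * (ρ⁻¹ * (ρ ^ d * mass ^ (d - 1))) := by
    have i1 : Integrable fun x => A' x * lap b (bump b z ρ) x :=
      ((continuous_affine A').mul (continuous_lap b ht.contDiff)).integrable_of_hasCompactSupport
        (hasCompactSupport_lap b ht.compact).mul_left
    have i2 : Integrable fun x => J * (max (inner ℝ ν (x - z)) 0 * lap b (bump b z ρ) x) :=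
      ((hmaxc.mul (continuous_lap b ht.contDiff)).integrable_of_hasCompactSupport
        (hasCompactSupport_lap b ht.compact).mul_left).const_mul J
    have e1 := integral_max_mul_lap_bump b z hρ ⟨0, hd0⟩
    rw [hb] at e1
    have e2 : ∫ x, w x * lap b (bump b z ρ) x = (∫ x, A' x * lap b (bump b z ρ) x) +
        ∫ x, J * (max (inner ℝ ν (x - z)) 0 * lap b (bump b z ρ) x) := by
      rw [← integral_add i1 i2]
      exact integral_congr_ae (Eventually.of_forall fun x => by simp only [hw]; ring)
    rw [ht.setIntegral_eq fun x hx => by rw [lap_eq_zero b hx, mul_zero], e2,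
      integral_affine_mul_lap b A' ht.contDiff ht.compact, integral_const_mul, e1, zero_add]
  have hbound : ∀ᵐ x ∂volume.restrict B, |Q x + sT x| ≤ C₁ * X * (1 + σ ^ 2) / h ^ 2 := by
    refine ae_restrict_of_subset_union hBT ?_ ?_
    · filter_upwards [hQae, hSae, ae_restrict_mem hmeas] with x h1 h2 hx
      rw [h1, h2, le_div_iff₀ (by positivity)]
      have h3 := helem Ω W D s WT Q sT hP X T c r A AQ As (M.interior_simplex_subset hLip hT) hE x hx
      have h4 : 0 ≤ C₁ * X * σ ^ 2 := by positivity
      linarith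
    · filter_upwards [hQae', hSae', ae_restrict_mem hmeas'] with x h1 h2 hx
      rw [h1, h2, le_div_iff₀ (by positivity)]
      have h3 := helem Ω W D s WT Q sT hP X T' c' r' A' AQ' As'
        (M.interior_simplex_subset hLip hT') hE' x hx
      have h4 : 0 ≤ C₁ * X := by positivity
      have h5 : h ^ 2 ≤ σ ^ 2 * size T' ^ 2 := by
        rw [← mul_pow]; exact pow_le_pow_left₀ hh.le hsz 2
      calc |AQ' x + As' x| * h ^ 2 ≤ |AQ' x + As' x| * (σ ^ 2 * size T' ^ 2) := by gcongr
        _ = σ ^ 2 * (size T' ^ 2 * |AQ' x + As' x|) := by ring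
        _ ≤ σ ^ 2 * (C₁ * X) := by gcongr
        _ ≤ C₁ * X * (1 + σ ^ 2) := by linarith
  have hvolB : volume B < ⊤ := (isCompact_closedBall z _).measure_lt_top
  have hg := abs_setIntegral_mul_le hvolB hbound (abs_bump_le_one b z ρ)
  have hvol : volume.real B = ρ ^ d * V := by
    rw [hB, volume_real_closedBall z (by positivity), mul_pow, hVdef]; ring
  rw [hint, ← hK] at key
  set I := ∫ x in B, (Q x + sT x) * bump b z ρ x
  have h1 : |J * (ρ⁻¹ * (ρ ^ d * mass ^ (d - 1)))| ≤
      ρ ^ d * ρ⁻¹ ^ 2 * (K * X') + C₁ * X * (1 + σ ^ 2) / h ^ 2 * 1 * (ρ ^ d * V) := by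
    rw [hvol] at hg
    have := abs_sub_abs_le_abs_sub (J * (ρ⁻¹ * (ρ ^ d * mass ^ (d - 1)))) (-I)
    rw [sub_neg_eq_add, abs_neg] at this
    linarith
  have h2 : C₁ * X * (1 + σ ^ 2) / h ^ 2 * 1 * (ρ ^ d * V) ≤
      ρ ^ d * ρ⁻¹ ^ 2 * (C₁ * X * (1 + σ ^ 2) * V) := by
    have h3 : (h ^ 2)⁻¹ ≤ (ρ⁻¹) ^ 2 := by
      rw [inv_pow]; gcongr
    calc C₁ * X * (1 + σ ^ 2) / h ^ 2 * 1 * (ρ ^ d * V)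
        = ρ ^ d * (h ^ 2)⁻¹ * (C₁ * X * (1 + σ ^ 2) * V) := by rw [div_eq_mul_inv]; ring
      _ ≤ _ := by gcongr
  rw [abs_mul, abs_of_pos (show 0 < ρ⁻¹ * (ρ ^ d * mass ^ (d - 1)) by positivity)] at h1
  -- The factor `ρ ^ (d - 1)` is `ρ ^ d * ρ⁻¹ ^ 2 * ρ`; the remaining `ρ` becomes the weight `h_T`
  -- of the jump.
  have h4 : |J| * (ρ⁻¹ * (ρ ^ d * mass ^ (d - 1)))
      = ρ ^ d * ρ⁻¹ ^ 2 * (mass ^ (d - 1) * (ρ * |J|)) := by field_simp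
  rw [h4] at h1
  have h5 : ρ ^ d * ρ⁻¹ ^ 2 * (mass ^ (d - 1) * (ρ * |J|)) ≤ ρ ^ d * ρ⁻¹ ^ 2 *
      ((K * (1 + weight d σ) + C₁ * (1 + σ ^ 2) * V) * X) := by
    refine h1.trans ((add_le_add_right h2 _).trans (le_of_eq ?_))
    rw [hX']; ring
  have h6 := le_of_mul_le_mul_left h5 (by positivity)
  have h7 : ρ * |J| ≤ (K * (1 + weight d σ) + C₁ * (1 + σ ^ 2) * V) / mass ^ (d - 1) * X := by
    rw [div_mul_eq_mul_div (K * _ + _), le_div_iff₀ (by positivity)]; linarith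
  have h8 : h = d ^ 2 * σ ^ 2 * ρ := by rw [hρdef]; field_simp
  calc h * |J| = d ^ 2 * σ ^ 2 * (ρ * |J|) := by rw [h8]; ring
    _ ≤ d ^ 2 * σ ^ 2 * ((K * (1 + weight d σ) + C₁ * (1 + σ ^ 2) * V) / mass ^ (d - 1) * X) := by
        gcongr
    _ = _ := by ring

/-! ### The residual indicator of one element -/

lemma size_nonneg (T : Finset (E d)) : 0 ≤ size T := Metric.diam_nonneg

lemma hE_rpow (hd3 : d ≤ 3) (T : Finset (E d)) :
    hE T ^ (2 - (d : ℝ) / 2) = ENNReal.ofReal (weight d (size T)) := by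
  have : (d : ℝ) ≤ 3 := by exact_mod_cast hd3
  exact ENNReal.ofReal_rpow_of_nonneg (size_nonneg T) (by linarith)

/-- The oscillation of `D` with respect to the approximation `Q`. -/
def oscWith (D Q : E d → ℝ) (N : Finset (Finset (E d))) : ℝ≥0∞ :=
  (∑ T ∈ N, hE T ^ (4 - (d : ℝ)) * l2Norm (fun x => D x - Q x) (simplex T) ^ 2) ^ (1 / 2 : ℝ)

/-- `4 - d` is twice `2 - d / 2`: the left side is the square root of a single summand. -/
lemma weight_mul_le_oscWith (hd3 : d ≤ 3) (D Q : E d → ℝ) {N : Finset (Finset (E d))}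
    {T : Finset (E d)} (hT : T ∈ N) :
    ENNReal.ofReal (weight d (size T)) * l2Norm (fun x => D x - Q x) (simplex T)
      ≤ oscWith D Q N := by
  have h1 : ENNReal.ofReal (weight d (size T)) * l2Norm (fun x => D x - Q x) (simplex T) =
      (hE T ^ (4 - (d : ℝ)) * l2Norm (fun x => D x - Q x) (simplex T) ^ 2) ^ (1 / 2 : ℝ) := by
    rw [ENNReal.mul_rpow_of_nonneg _ _ (by norm_num), ← ENNReal.rpow_mul, ← hE_rpow hd3,
      ← ENNReal.rpow_natCast, ← ENNReal.rpow_mul]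
    norm_num
    congr 2
    ring
  rw [h1]
  refine ENNReal.rpow_le_rpow ?_ (by norm_num)
  exact Finset.single_le_sum
    (f := fun T => hE T ^ (4 - (d : ℝ)) * l2Norm (fun x => D x - Q x) (simplex T) ^ 2)
    (fun _ _ => zero_le) hT

lemma simplex_subset_region {N : Finset (Finset (E d))} {T : Finset (E d)} (hT : T ∈ N) :
    simplex T ⊆ region N := subset_biUnion_of_mem (u := fun T => simplex T) hT

lemma ae_enorm_le_supNorm (g : E d → ℝ) (s : Set (E d)) :
    ∀ᵐ x ∂volume.restrict s, ‖g x‖ₑ ≤ supNorm g s := by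
  have := ae_le_eLpNormEssSup (f := g) (μ := volume.restrict s)
  simpa only [supNorm, eLpNorm_exponent_top] using this

lemma ae_abs_le_of_supNorm_le {g : E d → ℝ} {s : Set (E d)} {X : ℝ} (hX : 0 ≤ X)
    (h : supNorm g s ≤ ENNReal.ofReal X) : ∀ᵐ x ∂volume.restrict s, |g x| ≤ X := by
  filter_upwards [ae_enorm_le_supNorm g s] with x hx
  rw [← Real.norm_eq_abs]
  have h1 := hx.trans h
  rwa [← ofReal_norm, ENNReal.ofReal_le_ofReal_iff hX] at h1

lemma supNorm_mono {g : E d → ℝ} {s t : Set (E d)} (h : s ≤ᵐ[volume] t) :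
    supNorm g s ≤ supNorm g t := eLpNorm_mono_measure _ (Measure.restrict_mono' h le_rfl)

lemma Mesh.patch_subset (M : Mesh Ω) (T : Finset (E d)) : M.patch T ⊆ M.elems := by
  classical
  unfold Mesh.patch
  exact Finset.filter_subset _ _

lemma Mesh.self_mem_patch (M : Mesh Ω) {T : Finset (E d)} (hT : T ∈ M.elems) : T ∈ M.patch T := by
  classical
  unfold Mesh.patch
  exact Finset.mem_filter.2 ⟨hT, Or.inl rfl⟩

lemma Mesh.neighbour_mem_patch (M : Mesh Ω) {T T' S : Finset (E d)} (hT : T ∈ M.elems)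
    (hT' : T' ∈ M.elems) (hne : T' ≠ T) (hS : S.card = d) (hST : S ⊆ T) (hST' : S ⊆ T') :
    T' ∈ M.patch T := by
  classical
  unfold Mesh.patch
  exact Finset.mem_filter.2 ⟨hT', Or.inr ⟨S, ⟨hS, T, hT, T', hT', hne.symm, hST, hST'⟩, hST, hST'⟩⟩

lemma volume_simplex_le {T : Finset (E d)} {c : E d} (hc : c ∈ simplex T) :
    volume (simplex T) ≤ ENNReal.ofReal (size T ^ d * unitVol d) := by
  have h1 : simplex T ⊆ Metric.closedBall c (size T) := fun x hx => dist_le_size hx hc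
  refine (measure_mono h1).trans (le_of_eq ?_)
  rw [← volume_real_closedBall c (size_nonneg T), ofReal_measureReal
    (isCompact_closedBall c _).measure_lt_top.ne]

/-- The residual indicator is bounded by the local errors and the oscillation. -/
lemma exists_resInd_bound (hd : 2 ≤ d) (hd3 : d ≤ 3) (hΩb : Bornology.IsBounded Ω)
    (hLip : HasLipschitzBoundary Ω) (σ : ℝ) :
    ∃ C : ℝ≥0, ∀ (W D s WT Q sT : E d → ℝ), Problem Ω W D s → ∀ M : Mesh Ω, M.ShapeRegular σ →
      M.FE WT → M.FE sT → M.PiecewiseAffine Q → ∀ T ∈ M.elems,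
      M.resInd (fun x => D x + sT x) WT T ≤ C * (supNorm (fun x => W x - WT x) (region (M.patch T))
        + supNorm (fun x => s x - sT x) (region (M.patch T)) + oscWith D Q (M.patch T)) := by
  have hd0 : 0 < d := by omega
  by_cases hσ : 1 ≤ σ
  swap
  -- If `σ < 1` there is nothing to prove: `r ≤ h_T ≤ σ * r` is impossible, so the mesh has no
  -- elements.
  · refine ⟨0, fun W D s WT Q sT _ M hM _ _ _ T hT => absurd ?_ hσ⟩
    obtain ⟨c, r, hr, hb, hsz⟩ := hM T hT
    have := (le_size hd0 hr hb).trans hsz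
    exact (le_mul_iff_one_le_left hr).1 this
  set H := Metric.diam (closure Ω)
  obtain ⟨C₁, hC₁, helem⟩ := exists_element_bound (H := H) hd0 hd3 hσ
  obtain ⟨C₂, hC₂, hjump⟩ := exists_jump_bound (H := H) hd hd3 hσ
  have hV : 0 ≤ unitVol d := unitVol_nonneg
  set C : ℝ := 1 + √(unitVol d) * C₁ + C₂ with hC
  have hC0 : 0 < C := by positivity
  refine ⟨C.toNNReal, ?_⟩
  intro W D s WT Q sT hP M hM hWT hsT hQ T hT
  set Y := supNorm (fun x => W x - WT x) (region (M.patch T))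
    + supNorm (fun x => s x - sT x) (region (M.patch T)) + oscWith D Q (M.patch T) with hY
  -- With an infinite error the bound is trivial because `C > 0`; otherwise the finite real `X`
  -- measures all errors on the patch at once.
  rcases eq_or_ne Y ⊤ with hYtop | hYtop
  · rw [hYtop, ENNReal.mul_top]
    · exact le_top
    · simpa using hC0
  set X := Y.toReal with hXdef
  have hX : 0 ≤ X := ENNReal.toReal_nonneg
  have hYX : Y = ENNReal.ofReal X := (ENNReal.ofReal_toReal hYtop).symm
  have elem : ∀ T' ∈ M.patch T, ∃ c r A AQ As,
      ElemError σ H W D s WT Q sT X T' c r A AQ As := by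
    intro T' hT'
    have hT'M := M.patch_subset T hT'
    obtain ⟨c, r, hr, hb, hsz⟩ := hM T' hT'M
    obtain ⟨A, hA⟩ := hWT.2.1 T' hT'M
    obtain ⟨As, hAs⟩ := hsT.2.1 T' hT'M
    obtain ⟨AQ, hAQ⟩ := hQ T' hT'M
    have hsub : simplex T' ≤ᵐ[volume] region (M.patch T) :=
      LE.le.eventuallyLE (simplex_subset_region hT')
    have hfin : MemLp (fun x => D x - Q x) 2 (volume.restrict (simplex T')) := by
      rw [← Measure.restrict_congr_set (interior_ae_eq_simplex T')]
      refine (hP.memD.mono_measure (Measure.restrict_mono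
        (M.interior_simplex_subset hLip hT'M) le_rfl)).sub ?_
      refine (memLp_affine AQ (isBounded_interior_simplex T')).ae_eq ?_
      exact (ae_restrict_mem isOpen_interior.measurableSet).mono fun x hx => (hAQ x hx).symm
    refine ⟨c, r, A, AQ, As, ⟨hr, hb, hsz, ?_, hA, hAQ, hAs, hX, ?_, ?_, hfin.eLpNorm_ne_top, ?_⟩⟩
    · exact Metric.diam_mono (M.simplex_subset hT'M) hΩb.closure
    · refine ae_abs_le_of_supNorm_le hX ?_
      rw [← hYX, hY, add_assoc]
      exact (supNorm_mono hsub).trans le_self_add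
    · refine ae_abs_le_of_supNorm_le hX ?_
      rw [← hYX, hY, add_right_comm]
      exact (supNorm_mono hsub).trans le_add_self
    · have h1 : ENNReal.ofReal (weight d (size T')) * l2Norm (fun x => D x - Q x) (simplex T')
          ≤ Y := (weight_mul_le_oscWith hd3 D Q hT').trans le_add_self
      have h2 := ENNReal.toReal_mono hYtop h1
      rwa [ENNReal.toReal_mul, ENNReal.toReal_ofReal (weight_nonneg (size_nonneg T'))] at h2
  obtain ⟨c, r, A, AQ, As, hel⟩ := elem T (M.self_mem_patch hT)
  have hh : 0 < size T := hel.r_pos.trans_le (le_size hd0 hel.r_pos hel.ball)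
  have hcT : c ∈ simplex T := hel.ball (Metric.mem_closedBall_self hel.r_pos.le)
  have hmeas := measurableSet_simplex T
  have hQae : Q =ᵐ[volume.restrict (simplex T)] AQ :=
    (ae_mem_interior_simplex T).mono fun x hx => hel.eqQ x hx
  have hSae : sT =ᵐ[volume.restrict (simplex T)] As :=
    (ae_restrict_mem hmeas).mono fun x hx => hel.eqS x hx
  have hDT : MemLp D 2 (volume.restrict (simplex T)) := by
    rw [← Measure.restrict_congr_set (interior_ae_eq_simplex T)]
    exact hP.memD.mono_measure (Measure.restrict_mono (M.interior_simplex_subset hLip hT) le_rfl)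
  have hQT : MemLp Q 2 (volume.restrict (simplex T)) :=
    (memLp_affine AQ (isBounded_simplex T)).ae_eq hQae.symm
  have hST : MemLp sT 2 (volume.restrict (simplex T)) :=
    (memLp_affine As (isBounded_simplex T)).ae_eq hSae.symm
  have term₁ : hE T ^ (2 - (d : ℝ) / 2) * l2Norm (fun x => D x + sT x) (simplex T)
      ≤ ENNReal.ofReal X + ENNReal.ofReal (√(unitVol d) * C₁ * X) := by
    have h1 : l2Norm (fun x => D x + sT x) (simplex T) ≤
        l2Norm (fun x => D x - Q x) (simplex T) + l2Norm (fun x => Q x + sT x) (simplex T) := by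
      have := eLpNorm_add_le (hDT.sub hQT).1 (hQT.add hST).1 (p := 2) (by norm_num)
      refine le_trans (le_of_eq ?_) this
      refine congrArg (fun g => eLpNorm g 2 _) ?_
      ext x
      simp only [Pi.add_apply, Pi.sub_apply]
      ring
    -- The pointwise bound `C₁ * X / h ^ 2` times the square root of the volume; the weight then
    -- cancels all powers of `h`.
    have h2 : l2Norm (fun x => Q x + sT x) (simplex T) ≤
        ENNReal.ofReal (√(size T ^ d * unitVol d) * (C₁ * X / size T ^ 2)) := by
      have hb : ∀ᵐ x ∂volume.restrict (simplex T), ‖Q x + sT x‖ ≤ C₁ * X / size T ^ 2 := by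
        filter_upwards [hQae, hSae, ae_restrict_mem hmeas] with x h1 h2 hx
        rw [h1, h2, le_div_iff₀ (by positivity), mul_comm]
        exact helem Ω W D s WT Q sT hP X T c r A AQ As (M.interior_simplex_subset hLip hT) hel x hx
      refine (eLpNorm_le_of_ae_bound hb).trans ?_
      rw [Measure.restrict_apply_univ, ENNReal.ofReal_mul (Real.sqrt_nonneg _)]
      gcongr
      rw [Real.sqrt_eq_rpow, ← ENNReal.ofReal_rpow_of_nonneg (by positivity) (by norm_num)]
      norm_num
      exact ENNReal.rpow_le_rpow (volume_simplex_le hcT) (by norm_num)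
    rw [hE_rpow hd3]
    refine (mul_le_mul_right h1 _).trans ?_
    rw [mul_add]
    refine add_le_add ?_ ((mul_le_mul_right h2 _).trans (le_of_eq ?_))
    · rw [← hYX]
      exact (weight_mul_le_oscWith hd3 D Q (M.self_mem_patch hT)).trans le_add_self
    · rw [← ENNReal.ofReal_mul (weight_nonneg hh.le), Real.sqrt_mul (by positivity)]
      congr 1
      have := weight_mul_sqrt (d := d) hh
      calc weight d (size T) * (√(size T ^ d) * √(unitVol d) * (C₁ * X / size T ^ 2))
          = (weight d (size T) * √(size T ^ d)) / size T ^ 2 * (√(unitVol d) * C₁ * X) := by ring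
        _ = _ := by rw [this, div_self (by positivity), one_mul]
  have term₂ : hE T * M.jumpNorm WT T ≤ ENNReal.ofReal (C₂ * X) := by
    have h1 : M.jumpNorm WT T ≤ ENNReal.ofReal (C₂ * X / size T) := by
      refine iSup₂_le fun T' hT' => iSup₂_le fun S hS => ?_
      obtain ⟨hne, hcard, hST, hST'⟩ := hS
      obtain ⟨c', r', A', AQ', As', hE'⟩ :=
        elem T' (M.neighbour_mem_patch hT hT' hne hcard hST hST')
      rw [eLpNorm_exponent_top]
      refine eLpNormEssSup_le_of_ae_bound ?_
      filter_upwards [ae_restrict_mem (measurableSet_simplex S)] with x hx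
      rw [le_div_iff₀ hh, mul_comm]
      exact hjump Ω hLip W D s WT Q sT hP M X T T' S hT hT' hne hcard hST hST' c r A AQ As
        c' r' A' AQ' As' hel hE' x hx
    refine (mul_le_mul_right h1 _).trans (le_of_eq ?_)
    rw [hE, ← ENNReal.ofReal_mul hh.le]
    congr 1
    field_simp
  rw [Mesh.resInd]
  refine (add_le_add term₁ term₂).trans (le_of_eq ?_)
  rw [hYX, ← ENNReal.ofReal_add hX (by positivity), ← ENNReal.ofReal_add (by positivity)
    (by positivity), ← ENNReal.ofReal, ← ENNReal.ofReal_mul hC0.le]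
  congr 1
  rw [hC]; ring

/-! ### The control as a pointwise projection -/

/-- The variational inequality characterizes the control by a projection. -/
lemma control_eq_proj (hΩb : Bornology.IsBounded Ω) {lam a b : ℝ} (hlam : 0 < lam) (hab : a ≤ b)
    {p u : E d → ℝ} (hp : MemLp p 2 (volume.restrict Ω)) (hu : Uad Ω a b u)
    (hvar : ∀ v, Uad Ω a b v → 0 ≤ ∫ x in Ω, (p x + lam * u x) * (v x - u x)) :
    ∀ᵐ x ∂volume.restrict Ω, u x = proj a b (fun z => -p z / lam) x := by
  set v := proj a b fun z => -p z / lam with hv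
  have hfin : IsFiniteMeasure (volume.restrict Ω) :=
    ⟨by simpa using hΩb.measure_lt_top⟩
  have hvb : ∀ x, a ≤ v x ∧ v x ≤ b := fun x =>
    ⟨le_min hab (le_max_left _ _), min_le_left _ _⟩
  have hvm : AEStronglyMeasurable v (volume.restrict Ω) := by
    have h1 : AEMeasurable p (volume.restrict Ω) := hp.1.aemeasurable
    exact (aemeasurable_const.min (aemeasurable_const.max (h1.neg.div_const lam))).aestronglyMeasurable
  have hv2 : MemLp v 2 (volume.restrict Ω) := by
    refine MemLp.of_bound hvm (max |a| |b|) (Eventually.of_forall fun x => ?_)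
    exact abs_le_max_abs_abs (hvb x).1 (hvb x).2
  have hvad : Uad Ω a b v := ⟨hv2, Eventually.of_forall hvb⟩
  have h0 := hvar v hvad
  have hi1 : Integrable (fun x => (p x + lam * u x) * (v x - u x)) (volume.restrict Ω) :=
    (hp.add (hu.1.const_mul lam)).integrable_mul (q := 2) (hv2.sub hu.1)
  have hi2 : Integrable (fun x => (v x - u x) * (v x - u x)) (volume.restrict Ω) :=
    (hv2.sub hu.1).integrable_mul (q := 2) (hv2.sub hu.1)
  have hle : ∫ x in Ω, (p x + lam * u x) * (v x - u x)
      ≤ ∫ x in Ω, -lam * ((v x - u x) * (v x - u x)) := by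
    refine integral_mono_ae hi1 (hi2.const_mul _) ?_
    filter_upwards [hu.2] with x hx
    -- Obtuse angle property of the projection onto `[a, b]`. It gives `0 ≤ ∫ (p + λu)(v - u) ≤ -λ ∫
    -- (v - u)²`, forcing `u = v` almost everywhere.
    have hkey : (v x - -p x / lam) * (v x - u x) ≤ 0 := by
      set t := -p x / lam
      have hvx : v x = min b (max a t) := rfl
      rcases le_total t a with h | h
      · have : v x = a := by rw [hvx, max_eq_left h, min_eq_right hab]
        rw [this]
        exact mul_nonpos_of_nonneg_of_nonpos (by linarith) (by linarith [hx.1])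
      · rcases le_total t b with h' | h'
        · have : v x = t := by rw [hvx, max_eq_right h, min_eq_right h']
          rw [this]; simp
        · have : v x = b := by rw [hvx, max_eq_right h, min_eq_left h']
          rw [this]
          exact mul_nonpos_of_nonpos_of_nonneg (by linarith) (by linarith [hx.2])
    have e : (p x + lam * u x) * (v x - u x) = lam * ((v x - -p x / lam) * (v x - u x))
        + -lam * ((v x - u x) * (v x - u x)) := by field_simp; ring
    rw [e]
    linarith [mul_nonpos_of_nonneg_of_nonpos hlam.le hkey]
  rw [integral_const_mul] at hle
  have hnn : 0 ≤ ∫ x in Ω, (v x - u x) * (v x - u x) :=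
    integral_nonneg fun x => mul_self_nonneg _
  have hz : ∫ x in Ω, (v x - u x) * (v x - u x) = 0 := by
    by_contra hne
    have : 0 < ∫ x in Ω, (v x - u x) * (v x - u x) := lt_of_le_of_ne hnn (Ne.symm hne)
    have := mul_pos hlam this
    linarith
  have hae := (integral_eq_zero_iff_of_nonneg (fun x => mul_self_nonneg _) hi2).1 hz
  filter_upwards [hae] with x hx
  have := mul_self_eq_zero.1 hx
  linarith

lemma abs_proj_sub_le (a b s t : ℝ) :
    |min b (max a s) - min b (max a t)| ≤ |s - t| := by
  refine (abs_min_sub_min_le_max _ _ _ _).trans (max_le (by simp) ?_)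
  exact (abs_max_sub_max_le_max _ _ _ _).trans (max_le (by simp) le_rfl)

/-- Insert `u = Π(-p/λ)`: since `Π` is 1-Lipschitz, the difference of the projections costs `λ⁻¹ |p
- pT|`. -/
lemma indU_le {lam a b : ℝ} (hlam : 0 < lam) {p u pT uT : E d → ℝ} {T : Finset (E d)}
    (hu : ∀ᵐ x ∂volume.restrict (simplex T), u x = proj a b (fun z => -p z / lam) x) :
    indU lam a b uT pT T ≤ ENNReal.ofReal lam⁻¹ * supNorm (fun x => p x - pT x) (simplex T)
      + supNorm (fun x => u x - uT x) (simplex T) := by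
  rw [indU, supNorm, eLpNorm_exponent_top]
  refine eLpNormEssSup_le_of_ae_enorm_bound ?_
  filter_upwards [hu, ae_enorm_le_supNorm (fun x => p x - pT x) (simplex T),
    ae_enorm_le_supNorm (fun x => u x - uT x) (simplex T)] with x hx h1 h2
  have e : proj a b (fun z => -pT z / lam) x - uT x
      = (proj a b (fun z => -pT z / lam) x - proj a b (fun z => -p z / lam) x) + (u x - uT x) := by
    rw [hx]; ring
  rw [e]
  refine (enorm_add_le _ _).trans (add_le_add ?_ h2)
  refine le_trans ?_ (mul_le_mul_right h1 _)
  rw [← ofReal_norm, ← ofReal_norm, ← ENNReal.ofReal_mul (by positivity)]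
  refine ENNReal.ofReal_le_ofReal ((abs_proj_sub_le a b _ _).trans (le_of_eq ?_))
  rw [show -pT x / lam - -p x / lam = lam⁻¹ * (p x - pT x) by field_simp; ring, abs_mul,
    abs_of_pos (inv_pos.2 hlam), Real.norm_eq_abs]

/-! ### The coupled system -/

lemma IsSolution.state_problem {f yΩ y p u : E d → ℝ} {lam a b : ℝ}
    (h : IsSolution Ω f yΩ lam a b y p u) (hf : MemLp f 2 (volume.restrict Ω)) :
    Problem Ω y f u := by
  obtain ⟨G, hG, hsol⟩ := h.state
  exact ⟨fun b φ hφ => by rw [← hG.integral_inner_gradient b hφ, hsol φ _ hφ.isH10], hG.1, hf,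
    h.admissible.1⟩

lemma IsSolution.memLp_adjoint {f yΩ y p u : E d → ℝ} {lam a b : ℝ}
    (h : IsSolution Ω f yΩ lam a b y p u) : MemLp p 2 (volume.restrict Ω) := by
  obtain ⟨G, hG, -⟩ := h.adjoint
  exact hG.1

/-- The right side `y - yΩ` is split so that `-yΩ` is the datum carrying the oscillation and `y` the
coupled variable, whose error is measured in the sup norm. -/
lemma IsSolution.adjoint_problem {f yΩ y p u : E d → ℝ} {lam a b : ℝ}
    (h : IsSolution Ω f yΩ lam a b y p u) (hy : MemLp yΩ 2 (volume.restrict Ω)) :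
    Problem Ω p (fun x => -yΩ x) y := by
  obtain ⟨Gy, hGy, -⟩ := h.state
  obtain ⟨G, hG, hsol⟩ := h.adjoint
  refine ⟨fun b φ hφ => ?_, hG.1, hy.neg, hGy.1⟩
  rw [← hG.integral_inner_gradient b hφ]
  simp only [real_inner_comm (gradient φ _)]
  rw [hsol φ _ hφ.isH10]
  simp only [neg_add_eq_sub]

lemma sqrt_sum_sq_le (x y z : ℝ≥0∞) : (x ^ 2 + y ^ 2 + z ^ 2) ^ (1 / 2 : ℝ) ≤ x + y + z := by
  have h : x ^ 2 + y ^ 2 + z ^ 2 ≤ (x + y + z) ^ 2 := by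
    have e : (x + y + z) ^ 2 = x ^ 2 + y ^ 2 + z ^ 2 + 2 * (x * y + y * z + x * z) := by ring
    rw [e]
    exact le_self_add
  refine (ENNReal.rpow_le_rpow h (by norm_num)).trans (le_of_eq ?_)
  rw [← ENNReal.rpow_natCast, ← ENNReal.rpow_mul]
  norm_num

lemma le_sqrt_of_sq_le {x s : ℝ≥0∞} (h : x ^ 2 ≤ s) : x ≤ s ^ (1 / 2 : ℝ) := by
  refine le_trans (le_of_eq ?_) (ENNReal.rpow_le_rpow h (by norm_num))
  rw [← ENNReal.rpow_natCast, ← ENNReal.rpow_mul]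
  norm_num

lemma supNorm_le_totalError (ey ep eu : E d → ℝ) :
    supNorm ey Ω ≤ totalError Ω ey ep eu ∧ supNorm ep Ω ≤ totalError Ω ey ep eu ∧
      supNorm eu Ω ≤ totalError Ω ey ep eu := by
  refine ⟨le_sqrt_of_sq_le ?_, le_sqrt_of_sq_le ?_, le_sqrt_of_sq_le ?_⟩
  · rw [add_assoc]; exact le_self_add
  · rw [add_right_comm]; exact le_add_self
  · exact le_add_self

lemma oscWith_neg (M : Mesh Ω) (g : E d → ℝ) (N : Finset (Finset (E d))) :
    oscWith (fun x => -g x) (fun x => -M.l2Proj g x) N = M.osc g N := by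
  have h : ∀ s, l2Norm (fun x => -g x - -M.l2Proj g x) s = l2Norm (fun x => g x - M.l2Proj g x) s := by
    intro s
    rw [l2Norm, l2Norm, ← eLpNorm_neg]
    congr 1
    ext x
    simp only [Pi.neg_apply]
    ring
  simp only [oscWith, h, Mesh.osc]

/-- The bounds of the three local indicators. -/
lemma exists_indicator_bounds (hd : 2 ≤ d) (hd3 : d ≤ 3) (hΩb : Bornology.IsBounded Ω)
    (hLip : HasLipschitzBoundary Ω) {lam : ℝ} (hlam : 0 < lam) (σ : ℝ) :
    ∃ C : ℝ≥0, ∀ (a b : ℝ), a ≤ b →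
      ∀ (f yΩ : E d → ℝ), MemLp f 2 (volume.restrict Ω) → MemLp yΩ 2 (volume.restrict Ω) →
      ∀ (y p u : E d → ℝ), IsSolution Ω f yΩ lam a b y p u →
      ∀ M : Mesh Ω, M.ShapeRegular σ →
      ∀ (yT pT uT : E d → ℝ), M.FE yT → M.FE pT → M.FE uT → ∀ T ∈ M.elems,
        M.indY f yT uT T ≤ C * (supNorm (fun x => y x - yT x) (region (M.patch T)) +
          supNorm (fun x => u x - uT x) (region (M.patch T)) + M.osc f (M.patch T)) ∧
        M.indP yΩ pT yT T ≤ C * (supNorm (fun x => p x - pT x) (region (M.patch T)) +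
          supNorm (fun x => y x - yT x) (region (M.patch T)) + M.osc yΩ (M.patch T)) ∧
        indU lam a b uT pT T ≤ C * (supNorm (fun x => p x - pT x) (region (M.patch T)) +
          supNorm (fun x => u x - uT x) (region (M.patch T))) := by
  obtain ⟨C, hC⟩ := exists_resInd_bound hd hd3 hΩb hLip σ
  -- `C` serves the two residual indicators; `λ⁻¹` and `1` serve the control indicator.
  refine ⟨C + (lam⁻¹.toNNReal + 1), ?_⟩
  intro a b hab f yΩ hf hyΩ y p u hsol M hM yT pT uT hyT hpT huT T hT
  have hle : (C : ℝ≥0∞) ≤ (C + (lam⁻¹.toNNReal + 1) : ℝ≥0) := by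
    rw [ENNReal.coe_add]; exact le_self_add
  refine ⟨?_, ?_, ?_⟩
  · exact (hC y f u yT (M.l2Proj f) uT (hsol.state_problem hf) M hM hyT huT
      (M.piecewiseAffine_l2Proj hLip hf) T hT).trans (mul_le_mul_left hle _)
  · have h := hC p (fun x => -yΩ x) y pT (fun x => -M.l2Proj yΩ x) yT
      (hsol.adjoint_problem hyΩ) M hM hpT hyT (fun T hT => by
        obtain ⟨A, hA⟩ := M.piecewiseAffine_l2Proj hLip hyΩ T hT
        exact ⟨-A, fun x hx => congrArg Neg.neg (hA x hx)⟩) T hT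
    rw [oscWith_neg] at h
    simp only [neg_add_eq_sub] at h
    exact h.trans (mul_le_mul_left hle _)
  · have hsub : simplex T ≤ᵐ[volume] region (M.patch T) :=
      LE.le.eventuallyLE (simplex_subset_region (M.self_mem_patch hT))
    have hu := control_eq_proj hΩb hlam hab hsol.memLp_adjoint hsol.admissible hsol.variational
    have hu' : ∀ᵐ x ∂volume.restrict (simplex T), u x = proj a b (fun z => -p z / lam) x := by
      rw [← Measure.restrict_congr_set (interior_ae_eq_simplex T)]
      exact ae_mono (Measure.restrict_mono (M.interior_simplex_subset hLip hT) le_rfl) hu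
    refine (indU_le hlam hu').trans ?_
    rw [mul_add]
    refine add_le_add (mul_le_mul' ?_ (supNorm_mono hsub)) ?_
    · rw [ENNReal.ofReal, ENNReal.coe_le_coe, ← add_assoc, add_right_comm]
      exact le_add_self
    · refine (supNorm_mono hsub).trans (le_mul_of_one_le_left zero_le ?_)
      rw [ENNReal.one_le_coe_iff, ← add_assoc]
      exact le_add_self

end OCP

end

theorem theorem2 (d : ℕ) (hd : d = 2 ∨ d = 3) (Ω : Set (OCP.E d)) (hΩ : IsOpen Ω)
    (hΩb : Bornology.IsBounded Ω) (hΩL : OCP.HasLipschitzBoundary Ω)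
    (lam : ℝ) (hlam : 0 < lam) (σ : ℝ) :
    ∃ C : ℝ≥0, ∀ (a b : ℝ), a ≤ b →
      ∀ (f yΩ : OCP.E d → ℝ), MemLp f 2 (volume.restrict Ω) → MemLp yΩ 2 (volume.restrict Ω) →
      ∀ (y p u : OCP.E d → ℝ), OCP.IsSolution Ω f yΩ lam a b y p u →
      ∀ M : OCP.Mesh Ω, M.ShapeRegular σ →
      ∀ (yT pT uT : OCP.E d → ℝ), M.IsDiscreteSolution f yΩ lam a b yT pT uT →
        (∀ T ∈ M.elems,
          M.ind f yΩ lam a b yT pT uT T ≤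
            C * (OCP.supNorm (fun x => y x - yT x) (OCP.region (M.patch T)) +
              OCP.supNorm (fun x => p x - pT x) (OCP.region (M.patch T)) +
              OCP.supNorm (fun x => u x - uT x) (OCP.region (M.patch T)) +
              M.osc f (M.patch T) + M.osc yΩ (M.patch T))) ∧
        M.estimator f yΩ lam a b yT pT uT ≤
          C * (OCP.totalError Ω (fun x => y x - yT x) (fun x => p x - pT x)
                (fun x => u x - uT x) +
              (⨆ T ∈ M.elems, M.osc f (M.patch T)) +
              (⨆ T ∈ M.elems, M.osc yΩ (M.patch T))) := by
  obtain ⟨C, hC⟩ := OCP.exists_indicator_bounds (by omega) (by omega) hΩb hΩL hlam σ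
  -- In the global bound each of the three indicators contributes the total error twice.
  refine ⟨6 * C, ?_⟩
  intro a b hab f yΩ hf hyΩ y p u hsol M hM yT pT uT hdisc
  have hloc := hC a b hab f yΩ hf hyΩ y p u hsol M hM yT pT uT hdisc.state_mem hdisc.adjoint_mem
    hdisc.control_mem
  have hC6 : ((6 * C : ℝ≥0) : ℝ≥0∞) = 6 * C := by push_cast; rfl
  rw [hC6]
  constructor
  · intro T hT
    obtain ⟨h1, h2, h3⟩ := hloc T hT
    refine (OCP.sqrt_sum_sq_le _ _ _).trans ((add_le_add (add_le_add h1 h2) h3).trans ?_)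
    set ey := OCP.supNorm (fun x => y x - yT x) (OCP.region (M.patch T))
    set ep := OCP.supNorm (fun x => p x - pT x) (OCP.region (M.patch T))
    set eu := OCP.supNorm (fun x => u x - uT x) (OCP.region (M.patch T))
    set of := M.osc f (M.patch T)
    set oy := M.osc yΩ (M.patch T)
    have e : 6 * (C : ℝ≥0∞) * (ey + ep + eu + of + oy) =
        C * (ey + eu + of) + C * (ep + ey + oy) + C * (ep + eu)
          + C * (4 * ey + 4 * ep + 4 * eu + 5 * of + 5 * oy) := by ring
    rw [e]
    exact le_self_add
  · set t := OCP.totalError Ω (fun x => y x - yT x) (fun x => p x - pT x) (fun x => u x - uT x)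
    set Of := ⨆ T ∈ M.elems, M.osc f (M.patch T)
    set Oy := ⨆ T ∈ M.elems, M.osc yΩ (M.patch T)
    obtain ⟨ty, tp, tu⟩ := OCP.supNorm_le_totalError (Ω := Ω) (fun x => y x - yT x)
      (fun x => p x - pT x) (fun x => u x - uT x)
    -- Patches lie in `Ω` up to null sets, which suffices for essential suprema.
    have hreg : ∀ (T : Finset (OCP.E d)) (g : OCP.E d → ℝ),
        OCP.supNorm g (OCP.region (M.patch T)) ≤ OCP.supNorm g Ω := fun T g =>
      OCP.supNorm_mono (M.region_ae_subset hΩL (M.patch_subset T))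
    have b1 : (⨆ T ∈ M.elems, M.indY f yT uT T) ≤ C * (t + t + Of) :=
      iSup₂_le fun T hT => (hloc T hT).1.trans (mul_le_mul_right (add_le_add (add_le_add
        ((hreg T _).trans ty) ((hreg T _).trans tu))
          (le_iSup₂ (f := fun T (_ : T ∈ M.elems) => M.osc f (M.patch T)) T hT)) _)
    have b2 : (⨆ T ∈ M.elems, M.indP yΩ pT yT T) ≤ C * (t + t + Oy) :=
      iSup₂_le fun T hT => (hloc T hT).2.1.trans (mul_le_mul_right (add_le_add (add_le_add
        ((hreg T _).trans tp) ((hreg T _).trans ty))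
          (le_iSup₂ (f := fun T (_ : T ∈ M.elems) => M.osc yΩ (M.patch T)) T hT)) _)
    have b3 : (⨆ T ∈ M.elems, OCP.indU lam a b uT pT T) ≤ C * (t + t) :=
      iSup₂_le fun T hT => (hloc T hT).2.2.trans (mul_le_mul_right (add_le_add
        ((hreg T _).trans tp) ((hreg T _).trans tu)) _)
    refine (OCP.sqrt_sum_sq_le _ _ _).trans ((add_le_add (add_le_add b1 b2) b3).trans ?_)
    have e : 6 * (C : ℝ≥0∞) * (t + Of + Oy) =
        C * (t + t + Of) + C * (t + t + Oy) + C * (t + t) + C * (5 * Of + 5 * Oy) := by ring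
    rw [e]
    exact le_self_add
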